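/- Let $F$ be a countable subfield of $\mathbb{R}$. The theory $T[F]^*$, in the first-order language with symbols $0,1,+,\times,<$ and constants $c_a$ ($a\in F$), has the following axioms: (1) $0,+,<$ is an ordered abelian group; (2) $1,\times,<$ is a divisible ordered abelian group on the positive elements; (3) $c_{a+b}=c_a+c_b$ and $c_{ab}=c_a\times c_b$ for $a,b\in F$, and $0<c_a$ for $0<a\in F$; (4) $c_{a+b}\times x=(c_a\times x)+(c_b\times x)$ and $c_a\times(x+y)=(c_a\times x)+(c_a\times y)$ for $a,b\in F$. Call an ordered field $R$ extending the ordered field $F$ a *saturated extension* of $F$ if $R$ is countable and real closed and - whenever $A\subseteq R$ is finite and $g_i:R^{n_i}\to R$ ($i\in\mathbb{N}$) are functions definable in the ordered field $R$ with parameters from $A$, the set $\bigcup_i g_i[F^{n_i}]$ has an upper bound in $R$; and - whenever $g_1,\dots,g_k$ and $h_1,\dots,h_l$ are finitely many functions $g_i:R^{n_i}\to R$, $h_j:R^{m_j}\to R$ definable in $R$ with parameters from $R$, such that every element of each $g_i[F^{n_i}]$ is strictly less than every element of each $h_j[F^{m_j}]$, the set of $x\in R$ lying strictly above all the $g_i[F^{n_i}]$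 and strictly below all the $h_j[F^{m_j}]$ has at least two elements. An *$F$-bijection* of $R$ is an order-preserving bijection $h:R\to R$ with $h(0)=0$, $h(1)=1$ and $h(ax)=a\,h(x)$ for all $a\in F$, $x\in R$. The structure $h^{-1}[R]$ has domain $R$, the $0,1,+,<$ of $R$, interprets $c_a$ as $a$, and interprets $\times$ as $x\otimes y=h^{-1}(h(x)h(y))$. **Theorem.** Every countable subfield $F$ of $\mathbb{R}$ has a saturated extension. For every saturated extension $R$ of $F$ there is a model $M$ of $T[F]^*$ with domain $R$ and with the same $0,1,+,<$ as $R$ such that, writing $\otimes$ for the multiplication of $M$, for all $b\in R$, $$b\otimes(1+b)=b+b\otimes b\quad\text{if and only if}\quad b\in F.$$ Moreover, $M$ can be taken to be $h^{-1}[R]$ for some $F$-bijection $h$ of $R$. -/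

import Mathlib

namespace DistFree

open FirstOrder FirstOrder.Language

universe u

/-! ### The language and the theory `T[F]*` -/

/-- Function symbols: the constants `0`, `1`, `c_a` for `a ∈ F`, and the operations `+`, `×`. -/
inductive StarFunc (F : Subfield ℝ) : ℕ → Type
  | zero : StarFunc F 0
  | one : StarFunc F 0
  | const (a : F) : StarFunc F 0
  | add : StarFunc F 2
  | mul : StarFunc F 2

/-- The only relation symbol is `<`. -/
inductive StarRel : ℕ → Type
  | lt : StarRel 2

/-- The language `0, 1, +, ×, <, c_a (a ∈ F)`. -/
def starLang (F : Subfield ℝ) : Language := ⟨StarFunc F, StarRel⟩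

section Terms

variable {F : Subfield ℝ} {n : ℕ}

/-- Terms in `n` variables, and formulas in `n` variables. -/
abbrev Tm (F : Subfield ℝ) (n : ℕ) := (starLang F).Term (Empty ⊕ Fin n)

abbrev Fm (F : Subfield ℝ) (n : ℕ) := (starLang F).BoundedFormula Empty n

def tzero : Tm F n := Constants.term (L := starLang F) StarFunc.zero

def tone : Tm F n := Constants.term (L := starLang F) StarFunc.one

def tconst (a : F) : Tm F n := Constants.term (L := starLang F) (StarFunc.const a)

def tadd (s t : Tm F n) : Tm F n := Functions.apply₂ (L := starLang F) StarFunc.add s t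

def tmul (s t : Tm F n) : Tm F n := Functions.apply₂ (L := starLang F) StarFunc.mul s t

def tlt (s t : Tm F n) : Fm F n := Relations.boundedFormula₂ (L := starLang F) StarRel.lt s t

/-- The `k`-fold product of a term with itself. -/
def tpow (t : Tm F n) : ℕ → Tm F n
  | 0 => tone
  | k + 1 => tmul (tpow t k) t

end Terms

local infix:95 " ×ₜ " => tmul
local infix:90 " +ₜ " => tadd
local infix:88 " <ₜ " => tlt

/-- The axioms of `T[F]*`. Variables are `&0`, `&1`, `&2`, from the outermost quantifier inwards. -/
inductive StarAxiom (F : Subfield ℝ) : (starLang F).Sentence → Prop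
  -- `0, +, <` is an ordered abelian group
  | add_assoc : StarAxiom F (∀' ∀' ∀' ((&0 +ₜ &1) +ₜ &2 =' &0 +ₜ (&1 +ₜ &2)))
  | add_comm : StarAxiom F (∀' ∀' (&0 +ₜ &1 =' &1 +ₜ &0))
  | zero_add : StarAxiom F (∀' (tzero +ₜ &0 =' &0))
  | exists_neg : StarAxiom F (∀' ∃' (&0 +ₜ &1 =' tzero))
  | lt_irrefl : StarAxiom F (∀' ∼(&0 <ₜ &0))
  | lt_trans : StarAxiom F (∀' ∀' ∀' ((&0 <ₜ &1) ⟹ ((&1 <ₜ &2) ⟹ (&0 <ₜ &2))))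
  | lt_total : StarAxiom F (∀' ∀' ((&0 <ₜ &1) ⊔ ((&0 =' &1) ⊔ (&1 <ₜ &0))))
  | add_lt_add : StarAxiom F (∀' ∀' ∀' ((&0 <ₜ &1) ⟹ (&0 +ₜ &2 <ₜ &1 +ₜ &2)))
  -- `1, ×, <` is a divisible ordered abelian group on the positive elements
  | one_pos : StarAxiom F (tzero <ₜ tone)
  | mul_pos : StarAxiom F (∀' ∀' ((tzero <ₜ &0) ⟹ ((tzero <ₜ &1) ⟹ (tzero <ₜ &0 ×ₜ &1))))
  | mul_assoc : StarAxiom F (∀' ∀' ∀' ((tzero <ₜ &0) ⟹ ((tzero <ₜ &1) ⟹ ((tzero <ₜ &2) ⟹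
      ((&0 ×ₜ &1) ×ₜ &2 =' &0 ×ₜ (&1 ×ₜ &2))))))
  | mul_comm : StarAxiom F (∀' ∀' ((tzero <ₜ &0) ⟹ ((tzero <ₜ &1) ⟹ (&0 ×ₜ &1 =' &1 ×ₜ &0))))
  | one_mul : StarAxiom F (∀' ((tzero <ₜ &0) ⟹ (tone ×ₜ &0 =' &0)))
  | exists_inv : StarAxiom F (∀' ((tzero <ₜ &0) ⟹ ∃' ((tzero <ₜ &1) ⊓ (&0 ×ₜ &1 =' tone))))
  | mul_lt_mul : StarAxiom F (∀' ∀' ∀' ((tzero <ₜ &0) ⟹ ((tzero <ₜ &1) ⟹ ((tzero <ₜ &2) ⟹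
      ((&0 <ₜ &1) ⟹ (&0 ×ₜ &2 <ₜ &1 ×ₜ &2))))))
  | divisible (k : ℕ) (hk : 0 < k) :
      StarAxiom F (∀' ((tzero <ₜ &0) ⟹ ∃' ((tzero <ₜ &1) ⊓ (tpow (&1) k =' &0))))
  -- the constants
  | const_add (a b : F) : StarAxiom F (tconst (a + b) =' tconst a +ₜ tconst b)
  | const_mul (a b : F) : StarAxiom F (tconst (a * b) =' tconst a ×ₜ tconst b)
  | const_pos (a : F) (ha : 0 < a) : StarAxiom F (tzero <ₜ tconst a)
  -- distributivity for the constants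
  | const_add_mul (a b : F) :
      StarAxiom F (∀' (tconst (a + b) ×ₜ &0 =' (tconst a ×ₜ &0) +ₜ (tconst b ×ₜ &0)))
  | const_mul_add (a : F) :
      StarAxiom F (∀' ∀' (tconst a ×ₜ (&0 +ₜ &1) =' (tconst a ×ₜ &0) +ₜ (tconst a ×ₜ &1)))

/-- The theory `T[F]*`. -/
def starTheory (F : Subfield ℝ) : (starLang F).Theory := {φ | StarAxiom F φ}

/-- The interpretation of `×` in a structure for the language of `T[F]*`. -/
def mulIn {F : Subfield ℝ} {R : Type u} (M : (starLang F).Structure R) (x y : R) : R :=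
  M.funMap (n := 2) StarFunc.mul ![x, y]

/-- The structure `M` on `R` has the `0`, `1`, `+`, `<` of the ordered field `R`. -/
def SameAddOrder {F : Subfield ℝ} {R : Type u} [Field R] [LinearOrder R]
    (M : (starLang F).Structure R) : Prop :=
  (∀ v, M.funMap (n := 0) StarFunc.zero v = 0) ∧
  (∀ v, M.funMap (n := 0) StarFunc.one v = 1) ∧
  (∀ x y, M.funMap (n := 2) StarFunc.add ![x, y] = x + y) ∧
  (∀ x y, M.RelMap (n := 2) StarRel.lt ![x, y] ↔ x < y)

/-! ### `F`-bijections and the structure `h⁻¹[R]` -/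

section Bijections

variable {F : Subfield ℝ} {R : Type u} [Field R] [LinearOrder R]

/-- `h` is an `F`-bijection of `R`, an ordered field extending `F` through `ι`. -/
def IsFBijection (ι : F →+*o R) (h : R ≃o R) : Prop :=
  h 0 = 0 ∧ h 1 = 1 ∧ ∀ (a : F) (x : R), h (ι a * x) = ι a * h x

/-- The structure `h⁻¹[R]`: the symbols `0, 1, +, <` are those of `R`, `c_a` is `a`, and
`x × y` is `h⁻¹(h(x) h(y))`. -/
@[reducible]
noncomputable def hInv (ι : F →+*o R) (h : R ≃o R) : (starLang F).Structure R where
  funMap := fun f v =>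
    match f, v with
    | StarFunc.zero, _ => 0
    | StarFunc.one, _ => 1
    | StarFunc.const a, _ => ι a
    | StarFunc.add, v => v 0 + v 1
    | StarFunc.mul, v => h.symm (h (v 0) * h (v 1))
  RelMap := fun r v =>
    match r, v with
    | StarRel.lt, v => v 0 < v 1

end Bijections

/-! ### The fields `R` -/

/-- The first-order language of ordered rings. -/
abbrev ordRingLang : Language := Language.ring.sum Language.order

/-- An ordered field as a structure for the language of ordered rings. -/
@[reducible]
def ordRingStructure (R : Type u) [Field R] [LinearOrder R] : ordRingLang.Structure R :=
  letI : Language.ring.Structure R := (Ring.compatibleRingOfRing R).toStructure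
  letI : Language.order.Structure R := Language.orderStructure R
  Language.sumStructure Language.ring Language.order R

/-- `g : Rⁿ → R` is definable in the ordered field `R` with parameters from `A`. -/
def IsDefinableFun {R : Type u} [Field R] [LinearOrder R] (A : Set R) {n : ℕ}
    (g : (Fin n → R) → R) : Prop :=
  letI := ordRingStructure R
  A.DefinableFun ordRingLang g

/-- `R` is a countable real closed ordered field which extends `F` through the ordered embedding
`ι` and is saturated over `F`. -/
structure IsSaturatedExtension {F : Subfield ℝ} {R : Type u} [Field R] [LinearOrder R]
    [IsStrictOrderedRing R] (ι : F →+*o R) : Prop where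
  countable : Countable R
  realClosed : IsRealClosed R
  /-- The values at tuples from `F` of countably many functions that are definable with
  parameters from one finite set have a common upper bound. -/
  upperBound : ∀ (A : Set R), A.Finite → ∀ (n : ℕ → ℕ) (g : ∀ i, (Fin (n i) → R) → R),
    (∀ i, IsDefinableFun A (g i)) →
    ∃ b : R, ∀ (i : ℕ) (a : Fin (n i) → F), g i (fun j => ι (a j)) ≤ b
  /-- If the values at tuples from `F` of finitely many definable functions `g i` lie strictly
  below those of finitely many definable functions `h j`, then the interval strictly in between
  has at least two elements. -/
  interval : ∀ (k l : ℕ) (n : Fin k → ℕ) (m : Fin l → ℕ)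
    (g : ∀ i, (Fin (n i) → R) → R) (h : ∀ j, (Fin (m j) → R) → R),
    (∀ i, IsDefinableFun Set.univ (g i)) → (∀ j, IsDefinableFun Set.univ (h j)) →
    (∀ i j (a : Fin (n i) → F) (b : Fin (m j) → F),
      g i (fun s => ι (a s)) < h j (fun s => ι (b s))) →
    {x : R | (∀ i (a : Fin (n i) → F), g i (fun s => ι (a s)) < x) ∧
      ∀ j (b : Fin (m j) → F), x < h j (fun s => ι (b s))}.Nontrivial

end DistFree

/-!
The bijection `h` is built by back and forth from finite pieces. A piece is a set `S` of pairs,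
generated under multiplication by elements of `F` by `(1, 1)` and finitely many other pairs, which
is the graph of an order isomorphism (`IsPartialIso`). With `c = h(b)`, `d = h(1 + b)` and
`e = h⁻¹(c²)`, the equation `b ⊗ (1 + b) = b + b ⊗ b` says that `(b, c)`, `(1 + b, d)`, `(e, c²)`
and `(b + e, c d)` are all in the graph of `h`. A piece is generic (`IsGeneric`) if it contains no
such configuration with `b ∉ F`.

To extend a piece to a new element `x` of the domain, the image `y` has to be found in a certain
cut. This cut is given by definable functions with arguments in `F`, so saturation provides a
nontrivial interval of candidates (`IsSaturatedExtension.exists_cut`). As the subfield `F(A)` is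
bounded for finite `A`, one may choose `y` in this interval with `y² ∉ F(A)`, where `A` consists of
the coordinates of the generators (`IsSaturatedExtension.exists_sq_notMem`). Then a configuration
that uses the new pair is impossible unless `b ∈ F` (`IsGeneric.union_lines_of_sq_notMem`). New
elements of the range are dealt with in the same way (`IsGeneric.union_lines_of_notMem`).
Thus no configuration with `b ∉ F` ever arises, and the union of the pieces is the graph of the
desired `h`. The axioms of `T[F]*` hold in `h⁻¹[R]` for every `F`-bijection `h`, because `⊗` is
isomorphic to the multiplication of `R` and coincides with it if one factor is in `F`.

A saturated extension is found inside an ultrapower of `ℝ`, which is real closed and in which every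
cut between countable sets is filled (`UltraReal.exists_between`). A Löwenheim–Skolem argument
gives a countable elementary subfield that contains `F`, bounds for the values at tuples from `F` of
all functions definable with given parameters, and elements in the cuts between finitely many such
sets of values (`exists_countable_elementary_subfield`). By elementarity, these are the values of the
functions definable in the subfield (`valueSet_eq_range`).
-/

namespace DistFree

open FirstOrder FirstOrder.Language

universe u

/-! ### Definable functions in an ordered field -/

instance countable_ordRingLang_symbols : Countable ordRingLang.Symbols := by
  rw [← Cardinal.mk_le_aleph0_iff]
  change ordRingLang.card ≤ _
  rw [card_sum, Cardinal.add_le_aleph0, Cardinal.lift_le_aleph0, Cardinal.lift_le_aleph0,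
    Ring.card_ring, order.card_eq_one]
  exact ⟨(Cardinal.natCast_lt_aleph0 (n := 5)).le, Cardinal.one_le_aleph0⟩

section Definable

attribute [local instance] ordRingStructure

variable {R : Type u} [Field R] [LinearOrder R] {A : Set R} {n : ℕ}

theorem IsDefinableFun.mono {B : Set R} {f : (Fin n → R) → R} (hf : IsDefinableFun A f)
    (h : A ⊆ B) : IsDefinableFun B f :=
  Set.DefinableFun.mono hf h

theorem isDefinableFun_const {a : R} (ha : a ∈ A) : IsDefinableFun A fun _ : Fin n → R => a :=
  definableFun_const ordRingLang (Fin n) ha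

theorem isDefinableFun_proj (i : Fin n) : IsDefinableFun A fun v : Fin n → R => v i :=
  Set.DefinableFun.proj ordRingLang

/-- Reindexing the variables of a definable function. -/
theorem IsDefinableFun.comp_proj {m : ℕ} {f : (Fin n → R) → R} (hf : IsDefinableFun A f)
    (s : Fin n → Fin m) : IsDefinableFun A fun v : Fin m → R => f (v ∘ s) :=
  Set.DefinableFun.comp (g := fun v : Fin m → R => v ∘ s)
    (fun i => isDefinableFun_proj (s i)) hf

theorem isDefinableFun_funMap {k : ℕ} (s : ordRingLang.Functions k)
    {g : (Fin n → R) → Fin k → R} (hg : ∀ i, IsDefinableFun A fun v => g v i) :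
    IsDefinableFun A fun v => Structure.funMap s (g v) :=
  Set.DefinableFun.comp hg (Set.DefinableFun.of_empty (Set.DefinableFun.fun_symbol s))

variable {f g : (Fin n → R) → R}

theorem IsDefinableFun.add (hf : IsDefinableFun A f) (hg : IsDefinableFun A g) :
    IsDefinableFun A fun v => f v + g v :=
  isDefinableFun_funMap (g := fun v => ![f v, g v]) (Sum.inl Ring.addFunc)
    (Fin.forall_fin_two.2 ⟨hf, hg⟩)

theorem IsDefinableFun.mul (hf : IsDefinableFun A f) (hg : IsDefinableFun A g) :
    IsDefinableFun A fun v => f v * g v :=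
  isDefinableFun_funMap (g := fun v => ![f v, g v]) (Sum.inl Ring.mulFunc)
    (Fin.forall_fin_two.2 ⟨hf, hg⟩)

theorem IsDefinableFun.neg (hf : IsDefinableFun A f) : IsDefinableFun A fun v => -f v :=
  isDefinableFun_funMap (g := fun v => ![f v]) (Sum.inl Ring.negFunc)
    (Fin.forall_fin_one.2 hf)

theorem isDefinableFun_zero : IsDefinableFun A fun _ : Fin n → R => 0 :=
  isDefinableFun_funMap (g := fun _ => ![]) (Sum.inl Ring.zeroFunc) (fun i => i.elim0)

theorem isDefinableFun_one : IsDefinableFun A fun _ : Fin n → R => 1 :=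
  isDefinableFun_funMap (g := fun _ => ![]) (Sum.inl Ring.oneFunc) (fun i => i.elim0)

/-- The graph of the inverse is `{x, y | (x = 0 ∧ y = 0) ∨ x * y = 1}`. -/
theorem IsDefinableFun.inv (hf : IsDefinableFun A f) : IsDefinableFun A fun v => (f v)⁻¹ := by
  refine Set.DefinableFun.comp (f := fun w : Fin 1 → R => (w 0)⁻¹) (g := fun v => ![f v])
    (Fin.forall_fin_one.2 hf) ?_
  have h0 : A.Definable ordRingLang {w : Option (Fin 1) → R | w (some 0) = 0} :=
    (Set.DefinableFun.proj ordRingLang).ofPred_eq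
      (Set.DefinableFun.comp (g := fun _ => ![]) (fun i => i.elim0)
        (isDefinableFun_zero (n := 0)))
  have h0' : A.Definable ordRingLang {w : Option (Fin 1) → R | w none = 0} :=
    (Set.DefinableFun.proj ordRingLang).ofPred_eq
      (Set.DefinableFun.comp (g := fun _ => ![]) (fun i => i.elim0)
        (isDefinableFun_zero (n := 0)))
  have h1 : A.Definable ordRingLang {w : Option (Fin 1) → R | w (some 0) * w none = 1} :=
    Set.DefinableFun.ofPred_eq
      (Set.DefinableFun.comp (g := fun w : Option (Fin 1) → R => ![w (some 0), w none])
        (Fin.forall_fin_two.2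
          ⟨Set.DefinableFun.proj ordRingLang, Set.DefinableFun.proj ordRingLang⟩)
        (IsDefinableFun.mul (isDefinableFun_proj (n := 2) 0) (isDefinableFun_proj 1)))
      (Set.DefinableFun.comp (g := fun _ => ![]) (fun i => i.elim0)
        (isDefinableFun_one (n := 0)))
  unfold Set.DefinableFun
  convert! (h0.inter h0').union h1 using 1
  ext w
  simp only [Function.tupleGraph, Set.mem_ofPred_eq, Set.mem_union, Set.mem_inter_iff]
  by_cases h : w (some 0) = 0
  · simp [h, eq_comm]
  · simp only [Function.comp_apply, h, false_and, false_or]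
    constructor
    · intro e; rw [← e, mul_inv_cancel₀ h]
    · intro e; exact inv_eq_of_mul_eq_one_right e

theorem IsDefinableFun.ite_lt {f' g' : (Fin n → R) → R} (hf : IsDefinableFun A f)
    (hg : IsDefinableFun A g) (hf' : IsDefinableFun A f') (hg' : IsDefinableFun A g') :
    IsDefinableFun A fun v => if f v < g v then f' v else g' v := by
  have hlt : A.Definable ordRingLang {w : Fin 2 → R | w 0 < w 1} := by
    refine Set.Definable.mono (Set.empty_definable_iff.2 ⟨∼(Relations.formula₂
      (Sum.inr leSymb : ordRingLang.Relations 2) (Term.var 1) (Term.var 0)), ?_⟩)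
      (Set.empty_subset A)
    ext w
    rw [Set.mem_ofPred_eq, ← not_le]
    rfl
  refine Set.DefinableFun.ite ?_ hf' hg'
  exact hlt.preimage_map (F := fun v => ![f v, g v]) (Fin.forall_fin_two.2 ⟨hf, hg⟩)

end Definable

theorem countable_definableFun {R : Type u} [Field R] [LinearOrder R] {A : Set R}
    (hA : A.Finite) : Countable {p : Σ n : ℕ, (Fin n → R) → R // IsDefinableFun A p.2} := by
  let := ordRingStructure R
  have := hA.to_subtype
  have h (p : {p : Σ n : ℕ, (Fin n → R) → R // IsDefinableFun A p.2}) := p.2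
  choose φ hφ using h
  refine Function.Injective.countable
    (β := Σ n : ℕ, ordRingLang[[A]].Formula (Option (Fin n))) (f := fun p => ⟨p.1.1, φ p⟩) ?_
  rintro ⟨⟨n, f⟩, hf⟩ ⟨⟨m, g⟩, hg⟩ h
  obtain ⟨rfl, h⟩ := Sigma.mk.inj_iff.1 h
  have h1 := hφ ⟨⟨n, f⟩, hf⟩
  rw [eq_of_heq h, ← hφ ⟨⟨n, g⟩, hg⟩] at h1
  have : f = g := by
    ext v
    have h2 : (fun o : Option (Fin n) => o.elim (f v) v) ∈ Function.tupleGraph f := rfl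
    rw [h1] at h2
    exact h2.symm
  subst this
  rfl

/-! ### Generic elements of intervals -/

section Generic

variable {F : Subfield ℝ} {R : Type u} [Field R] [LinearOrder R]
  {ι : F →+*o R}

/-- The subfield `F(A)` of `R`. -/
def adjoin (ι : F →+*o R) (A : Set R) : Subfield R := Subfield.closure (Set.range ι ∪ A)

theorem map_mem_adjoin {A : Set R} (a : F) : ι a ∈ adjoin ι A :=
  Subfield.subset_closure (Or.inl ⟨a, rfl⟩)

theorem mem_adjoin {A : Set R} {x : R} (hx : x ∈ A) : x ∈ adjoin ι A :=
  Subfield.subset_closure (Or.inr hx)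

theorem adjoin_mono {A B : Set R} (h : A ⊆ B) : adjoin ι A ≤ adjoin ι B :=
  Subfield.closure_mono (Set.union_subset_union_right _ h)

/-- Each element of `F(A)` is the value at a tuple from `F` of a function definable over `A`. -/
theorem exists_definableFun_of_mem_adjoin {A : Set R} {x : R} (hx : x ∈ adjoin ι A) :
    ∃ (n : ℕ) (g : (Fin n → R) → R) (a : Fin n → F),
      IsDefinableFun A g ∧ g (fun i => ι (a i)) = x := by
  -- two tuples are concatenated to apply a binary operation to two values
  have key : ∀ op : R → R → R, (∀ (n : ℕ) (f g : (Fin n → R) → R), IsDefinableFun A f →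
      IsDefinableFun A g → IsDefinableFun A fun v => op (f v) (g v)) → ∀ x y : R,
      (∃ (n : ℕ) (g : (Fin n → R) → R) (a : Fin n → F),
        IsDefinableFun A g ∧ g (fun i => ι (a i)) = x) →
      (∃ (n : ℕ) (g : (Fin n → R) → R) (a : Fin n → F),
        IsDefinableFun A g ∧ g (fun i => ι (a i)) = y) →
      ∃ (n : ℕ) (g : (Fin n → R) → R) (a : Fin n → F),
        IsDefinableFun A g ∧ g (fun i => ι (a i)) = op x y := by
    rintro op hop _ _ ⟨n, f, a, hf, rfl⟩ ⟨m, g, b, hg, rfl⟩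
    refine ⟨n + m, _, Fin.append a b, hop _ _ _ (hf.comp_proj (Fin.castAdd m))
      (hg.comp_proj (Fin.natAdd n)), ?_⟩
    simp [Function.comp_def]
  refine Subfield.closure_induction ?_ ?_ ?_ ?_ ?_ ?_ hx
  · rintro x (⟨a, rfl⟩ | hx)
    · exact ⟨1, _, fun _ => a, isDefinableFun_proj 0, rfl⟩
    · exact ⟨0, _, Fin.elim0, isDefinableFun_const hx, rfl⟩
  · exact ⟨0, _, Fin.elim0, isDefinableFun_one, rfl⟩
  · exact fun x y _ _ => key (· + ·) (fun _ _ _ => IsDefinableFun.add) x y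
  · rintro _ _ ⟨n, g, a, hg, rfl⟩
    exact ⟨n, _, a, hg.neg, rfl⟩
  · rintro _ _ ⟨n, g, a, hg, rfl⟩
    exact ⟨n, _, a, hg.inv, rfl⟩
  · exact fun x y _ _ => key (· * ·) (fun _ _ _ => IsDefinableFun.mul) x y

/-- For finite `A`, the subfield `F(A)` is bounded in a saturated extension `R` of `F`. -/
theorem IsSaturatedExtension.exists_bound [IsStrictOrderedRing R] (hι : IsSaturatedExtension ι)
    {A : Set R}
    (hA : A.Finite) : ∃ N, ∀ x ∈ adjoin ι A, x < N := by
  have := countable_definableFun hA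
  have : Nonempty {p : Σ n : ℕ, (Fin n → R) → R // IsDefinableFun A p.2} :=
    ⟨⟨⟨0, fun _ => 0⟩, isDefinableFun_zero⟩⟩
  obtain ⟨e, he⟩ := exists_surjective_nat {p : Σ n : ℕ, (Fin n → R) → R // IsDefinableFun A p.2}
  obtain ⟨N, hN⟩ := hι.upperBound A hA (fun i => (e i).1.1) (fun i => (e i).1.2)
    (fun i => (e i).2)
  refine ⟨N, fun x hx => ?_⟩
  obtain ⟨n, g, a, hg, hx'⟩ := exists_definableFun_of_mem_adjoin (add_mem hx (one_mem _))
  obtain ⟨i, hi⟩ := he ⟨⟨n, g⟩, hg⟩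
  have key : ∀ p : {p : Σ n : ℕ, (Fin n → R) → R // IsDefinableFun A p.2}, e i = p →
      ∀ a : Fin p.1.1 → F, p.1.2 (fun j => ι (a j)) ≤ N := by
    rintro p rfl a
    exact hN i a
  have := key _ hi a
  dsimp only at this
  rw [hx'] at this
  linarith

/-- Every interval contains an element whose square is not in `F(A)`: with `ε` the inverse of a
bound of `F(A, u, v)`, the element `u + ε` is one, as no positive element of `F(A, u, v)` is
below `ε` and the difference of its square from `u ^ 2` is a multiple of `ε` that is too small. -/
theorem IsSaturatedExtension.exists_sq_notMem [IsStrictOrderedRing R] (hι : IsSaturatedExtension ι)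
    {A : Set R}
    (hA : A.Finite) {u v : R} (huv : u < v) :
    ∃ y, u < y ∧ y < v ∧ y ^ 2 ∉ adjoin ι A := by
  obtain ⟨N, hN⟩ := hι.exists_bound (hA.insert u |>.insert v)
  set K := adjoin ι (insert v (insert u A)) with hK
  have hu : u ∈ K := mem_adjoin (by simp)
  have hv : v ∈ K := mem_adjoin (by simp)
  have hN1 : 1 < N := hN 1 (one_mem _)
  have hN0 : 0 < N := zero_lt_one.trans hN1
  have hsmall : ∀ x ∈ K, 0 < x → N⁻¹ < x := fun x hx hx0 =>
    inv_lt_of_inv_lt₀ hx0 (hN _ (inv_mem hx))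
  have hε0 : 0 < N⁻¹ := inv_pos.2 hN0
  have hε1 : N⁻¹ < 1 := inv_lt_one_of_one_lt₀ hN1
  refine ⟨u + N⁻¹, by linarith, by linarith [hsmall _ (sub_mem hv hu) (sub_pos.2 huv)], fun h => ?_⟩
  have hk : N⁻¹ * (2 * u + N⁻¹) ∈ K := by
    have := sub_mem (adjoin_mono (by intro x hx; simp [hx]) h : (u + N⁻¹) ^ 2 ∈ K) (pow_mem hu 2)
    convert this using 1; ring
  have hne : 2 * u + N⁻¹ ≠ 0 := by
    intro h0
    have : N⁻¹ ∈ K := by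
      rw [show N⁻¹ = -(2 * u) by linarith]
      exact neg_mem (mul_mem (ofNat_mem K 2) hu)
    exact lt_irrefl _ (hsmall _ this hε0)
  have habs : ∀ x ∈ K, |x| ∈ K := fun x hx => by
    rcases abs_choice x with h | h <;> rw [h]
    exacts [hx, neg_mem hx]
  have hw : 2 * |u| + 1 ∈ K := add_mem (mul_mem (ofNat_mem K 2) (habs _ hu)) (one_mem _)
  have hw0 : 0 < 2 * |u| + 1 := by positivity
  have h1 := hsmall _ (div_mem (habs _ hk) hw)
    (div_pos (abs_pos.2 (mul_ne_zero hε0.ne' hne)) hw0)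
  rw [lt_div_iff₀ hw0, abs_mul, abs_of_pos hε0] at h1
  have h2 := lt_of_mul_lt_mul_left h1 hε0.le
  have h3 := abs_add_le (2 * u) N⁻¹
  rw [abs_mul, abs_two, abs_of_pos hε0] at h3
  linarith

end Generic

/-! ### Partial isomorphisms -/

section PartialIso

variable {F : Subfield ℝ} {R : Type u} [Field R] [LinearOrder R] {ι : F →+*o R}

/-- The set of `F`-multiples of the pairs in `T`. -/
def lines (ι : F →+*o R) (T : Set (R × R)) : Set (R × R) :=
  {p | ∃ a : F, ∃ q ∈ T, p = (ι a * q.1, ι a * q.2)}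

/-- A partial `F`-isomorphism: the lines through the pairs in a finite set, one of which is
`(1, 1)`, that form the graph of an order isomorphism between two subsets of `R`. -/
structure IsPartialIso (ι : F →+*o R) (S : Set (R × R)) : Prop where
  one_mem : (1, 1) ∈ S
  lt_iff : ∀ p ∈ S, ∀ q ∈ S, p.1 < q.1 ↔ p.2 < q.2
  exists_lines : ∃ T : Set (R × R), T.Finite ∧ S = lines ι T

/-- If `S` is the graph of an `F`-bijection `h`, then `b ⊗ (1 + b) = b + b ⊗ b` in `h⁻¹[R]` exactly
if there are `c, d, e` such that the four pairs below are in `S`. This shall only happen for `b` in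
`F`. -/
def IsGeneric (ι : F →+*o R) (S : Set (R × R)) : Prop :=
  ∀ b c d e : R, (b, c) ∈ S → (1 + b, d) ∈ S → (e, c ^ 2) ∈ S → (b + e, c * d) ∈ S →
    b ∈ Set.range ι

theorem subset_lines (T : Set (R × R)) : T ⊆ lines ι T :=
  fun p hp => ⟨1, p, hp, by simp⟩

theorem lines_mono {T T' : Set (R × R)} (h : T ⊆ T') : lines ι T ⊆ lines ι T' := by
  rintro _ ⟨a, q, hq, rfl⟩
  exact ⟨a, q, h hq, rfl⟩

theorem lines_insert (p : R × R) (T : Set (R × R)) :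
    lines ι (insert p T) = lines ι T ∪ lines ι {p} := by
  refine Set.Subset.antisymm ?_ (Set.union_subset (lines_mono (Set.subset_insert _ _))
    (lines_mono (by simp)))
  rintro _ ⟨a, q, rfl | hq, rfl⟩
  exacts [Or.inr ⟨a, q, rfl, rfl⟩, Or.inl ⟨a, q, hq, rfl⟩]

theorem image_swap_lines (T : Set (R × R)) :
    Prod.swap '' lines ι T = lines ι (Prod.swap '' T) := by
  ext p
  constructor
  · rintro ⟨_, ⟨a, q, hq, rfl⟩, rfl⟩
    exact ⟨a, q.swap, ⟨q, hq, rfl⟩, rfl⟩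
  · rintro ⟨a, _, ⟨q, hq, rfl⟩, rfl⟩
    exact ⟨_, ⟨a, q, hq, rfl⟩, rfl⟩

namespace IsPartialIso

variable {S : Set (R × R)}

theorem smul_mem (hS : IsPartialIso ι S) {p : R × R} (hp : p ∈ S) (a : F) :
    (ι a * p.1, ι a * p.2) ∈ S := by
  obtain ⟨T, -, rfl⟩ := hS.exists_lines
  obtain ⟨b, q, hq, rfl⟩ := hp
  exact ⟨a * b, q, hq, by simp [mul_assoc]⟩

theorem map_mem (hS : IsPartialIso ι S) (a : F) : (ι a, ι a) ∈ S := by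
  simpa using hS.smul_mem hS.one_mem a

theorem zero_mem (hS : IsPartialIso ι S) : (0, 0) ∈ S := by
  simpa using hS.map_mem 0

theorem eq_iff (hS : IsPartialIso ι S) {p q : R × R} (hp : p ∈ S) (hq : q ∈ S) :
    p.1 = q.1 ↔ p.2 = q.2 := by
  rw [le_antisymm_iff, le_antisymm_iff, ← not_lt, ← not_lt, ← not_lt, ← not_lt,
    hS.lt_iff p hp q hq, hS.lt_iff q hq p hp]

theorem image_swap (hS : IsPartialIso ι S) : IsPartialIso ι (Prod.swap '' S) where
  one_mem := ⟨_, hS.one_mem, rfl⟩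
  lt_iff := by
    rintro _ ⟨p, hp, rfl⟩ _ ⟨q, hq, rfl⟩
    exact (hS.lt_iff p hp q hq).symm
  exists_lines := by
    obtain ⟨T, hT, rfl⟩ := hS.exists_lines
    exact ⟨_, hT.image _, image_swap_lines T⟩

variable [IsStrictOrderedRing R]

/-- A pair can be added to a partial isomorphism if its coordinates realize corresponding cuts. -/
theorem union_lines (hS : IsPartialIso ι S) {x y : R}
    (h1 : ∀ p ∈ S, p.1 < x ↔ p.2 < y) (h2 : ∀ p ∈ S, x < p.1 ↔ y < p.2) :
    IsPartialIso ι (S ∪ lines ι {(x, y)}) where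
  one_mem := Or.inl hS.one_mem
  exists_lines := by
    obtain ⟨T, hT, rfl⟩ := hS.exists_lines
    exact ⟨insert (x, y) T, hT.insert _, (lines_insert _ _).symm⟩
  lt_iff := by
    have hpos : ∀ {a : F}, 0 < a → 0 < ι a := fun {a} ha => by
      have : ι 0 < ι a := ι.monotone'.strictMono_of_injective ι.toRingHom.injective ha
      simpa using this
    have key1 : ∀ p ∈ S, ∀ a : F, p.1 < ι a * x ↔ p.2 < ι a * y := by
      intro p hp a
      rcases lt_trichotomy a 0 with ha | rfl | ha
      · have ha' : 0 < ι (-a) := hpos (by simpa using ha)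
        have := h2 _ (hS.smul_mem hp ((-a)⁻¹ * -1))
        have e : ∀ s t : R, s < ι ((-a)⁻¹ * -1) * t ↔ t < ι a * s := fun s t => by
          rw [map_mul, map_inv₀, mul_assoc, lt_inv_mul_iff₀ ha']
          simp only [map_neg, map_one]
          constructor <;> intro h <;> linarith
        rw [e, e] at this
        exact this
      · simpa using hS.lt_iff p hp _ hS.zero_mem
      · have ha' := hpos ha
        have := h1 _ (hS.smul_mem hp a⁻¹)
        simp only [map_inv₀] at this
        rwa [inv_mul_lt_iff₀ ha', inv_mul_lt_iff₀ ha'] at this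
    have key2 : ∀ p ∈ S, ∀ a : F, ι a * x < p.1 ↔ ι a * y < p.2 := by
      intro p hp a
      have := key1 _ (hS.smul_mem hp (-1)) (-a)
      simpa using this
    have key3 : ∀ a b : F, ι a * x < ι b * x ↔ ι a * y < ι b * y := by
      intro a b
      have := key1 _ hS.zero_mem (b - a)
      simpa [sub_mul] using this
    rintro p (hp | ⟨a, _, rfl, rfl⟩) q (hq | ⟨b, _, rfl, rfl⟩)
    · exact hS.lt_iff p hp q hq
    · exact key1 p hp b
    · exact key2 q hq a
    · exact key3 a b

end IsPartialIso

theorem IsPartialIso.exists_finite_adjoin {S : Set (R × R)} (hS : IsPartialIso ι S) :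
    ∃ A : Set R, A.Finite ∧ ∀ p ∈ S, p.1 ∈ adjoin ι A ∧ p.2 ∈ adjoin ι A := by
  obtain ⟨T, hT, rfl⟩ := hS.exists_lines
  refine ⟨Prod.fst '' T ∪ Prod.snd '' T, (hT.image _).union (hT.image _), ?_⟩
  rintro _ ⟨a, q, hq, rfl⟩
  exact ⟨mul_mem (map_mem_adjoin a) (mem_adjoin (Or.inl ⟨q, hq, rfl⟩)),
    mul_mem (map_mem_adjoin a) (mem_adjoin (Or.inr ⟨q, hq, rfl⟩))⟩

omit [LinearOrder R] in
theorem eq_zero_or_mem_of_mul_mem {K : Subfield R} {a y : R} (ha : a ∈ K) (h : a * y ∈ K) :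
    a = 0 ∨ y ∈ K := by
  refine or_iff_not_imp_left.2 fun h0 => ?_
  have := mul_mem (inv_mem ha) h
  rwa [inv_mul_cancel_left₀ h0] at this

/-- Adding a pair with a generic second coordinate `y` preserves genericity: `y ^ 2 ∉ K` rules out
that `c` is a new value, then `c ^ 2` is old, and `d` and `c * d` being new would put `c` into
`F`. -/
theorem IsGeneric.union_lines_of_sq_notMem {S : Set (R × R)} (hS : IsPartialIso ι S)
    (hgen : IsGeneric ι S) {K : Subfield R} (hFK : ∀ a, ι a ∈ K) (hSK : ∀ p ∈ S, p.2 ∈ K)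
    {x y : R} (hy : y ^ 2 ∉ K) : IsGeneric ι (S ∪ lines ι {(x, y)}) := by
  have hyK : y ∉ K := fun h => hy (pow_mem h 2)
  -- each pair is old, or a multiple of the new one by a nonzero factor
  have hcases : ∀ s t : R, (s, t) ∈ S ∪ lines ι {(x, y)} →
      (s, t) ∈ S ∨ ∃ a : F, ι a ≠ 0 ∧ s = ι a * x ∧ t = ι a * y := by
    rintro s t (h | ⟨a, _, rfl, h⟩)
    · exact Or.inl h
    · obtain ⟨rfl, rfl⟩ := Prod.ext_iff.1 h
      by_cases ha : ι a = 0
      · exact Or.inl (by simpa [ha] using hS.zero_mem)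
      · exact Or.inr ⟨a, ha, rfl, rfl⟩
  have hold : ∀ s t : R, (s, t) ∈ S ∪ lines ι {(x, y)} → t ∈ K → (s, t) ∈ S := by
    intro s t h ht
    obtain h | ⟨a, ha, -, rfl⟩ := hcases s t h
    · exact h
    · exact absurd ht fun ht => (eq_zero_or_mem_of_mul_mem (hFK a) ht).elim ha hyK
  intro b c d e hb hd he hbe
  obtain hb | ⟨a, ha, -, rfl⟩ := hcases _ _ hb
  · have hcK : c ∈ K := hSK _ hb
    have he := hold _ _ he (pow_mem hcK 2)
    obtain hd | ⟨a, ha, -, rfl⟩ := hcases _ _ hd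
    · exact hgen b c d e hb hd he (hold _ _ hbe (mul_mem hcK (hSK _ hd)))
    · obtain hbe | ⟨a', -, -, h⟩ := hcases _ _ hbe
      · have := hSK _ hbe
        dsimp only at this
        rw [← mul_assoc] at this
        obtain h | h := eq_zero_or_mem_of_mul_mem (mul_mem hcK (hFK a)) this
        · rw [mul_eq_zero, or_iff_left ha] at h
          exact ⟨0, by simpa using ((hS.eq_iff hb hS.zero_mem).2 h).symm⟩
        · exact absurd h hyK
      · have hy0 : y ≠ 0 := fun h => hyK (h ▸ zero_mem K)
        rw [← mul_assoc] at h
        have hc : c = ι (a' / a) := by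
          rw [map_div₀, eq_div_iff ha, mul_right_cancel₀ hy0 h]
        exact ⟨a' / a, ((hS.eq_iff hb (hS.map_mem (a' / a))).2 hc).symm⟩
  · exfalso
    rw [mul_pow] at he
    have ha2 : ι a ^ 2 ∈ K := pow_mem (hFK a) 2
    obtain he | ⟨a', -, -, h⟩ := hcases _ _ he
    · exact (eq_zero_or_mem_of_mul_mem ha2 (hSK _ he)).elim (pow_ne_zero 2 ha) hy
    · have hy0 : y ≠ 0 := fun h => hyK (h ▸ zero_mem K)
      rw [sq y, ← mul_assoc] at h
      have := mul_right_cancel₀ hy0 h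
      exact (eq_zero_or_mem_of_mul_mem ha2 (this ▸ hFK a')).elim (pow_ne_zero 2 ha) hyK

/-- Adding a pair with a generic first coordinate `x` preserves genericity: `b` and `1 + b` cannot
both be multiples of `x` or in `K` unless they are in `K`, and the same holds for `e` and
`b + e`. -/
theorem IsGeneric.union_lines_of_notMem {S : Set (R × R)} (hS : IsPartialIso ι S)
    (hgen : IsGeneric ι S) {K : Subfield R} (hFK : ∀ a, ι a ∈ K) (hSK : ∀ p ∈ S, p.1 ∈ K)
    {x y : R} (hx : x ∉ K) : IsGeneric ι (S ∪ lines ι {(x, y)}) := by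
  have hcases : ∀ s t : R, (s, t) ∈ S ∪ lines ι {(x, y)} →
      (s, t) ∈ S ∨ ∃ a : F, ι a ≠ 0 ∧ s = ι a * x := by
    rintro s t (h | ⟨a, _, rfl, h⟩)
    · exact Or.inl h
    · obtain ⟨rfl, rfl⟩ := Prod.ext_iff.1 h
      by_cases ha : ι a = 0
      · exact Or.inl (by simpa [ha] using hS.zero_mem)
      · exact Or.inr ⟨a, ha, rfl⟩
  -- two pairs whose first coordinates differ by a nonzero element of `K` are both old
  have hold : ∀ s t s' t' : R, (s, t) ∈ S ∪ lines ι {(x, y)} → (s', t') ∈ S ∪ lines ι {(x, y)} →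
      s' - s ∈ K → s' - s ≠ 0 → (s, t) ∈ S ∧ (s', t') ∈ S := by
    intro s t s' t' h h' hK h0
    obtain h | ⟨a, ha, rfl⟩ := hcases s t h <;> obtain h' | ⟨a', ha', rfl⟩ := hcases s' t' h'
    · exact ⟨h, h'⟩
    · have := add_mem hK (hSK _ h)
      rw [sub_add_cancel] at this
      exact absurd this fun h => (eq_zero_or_mem_of_mul_mem (hFK a') h).elim ha' hx
    · have := sub_mem (hSK _ h') hK
      rw [sub_sub_cancel] at this
      exact absurd this fun h => (eq_zero_or_mem_of_mul_mem (hFK a) h).elim ha hx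
    · rw [← sub_mul] at hK h0
      exact absurd hK fun h => (eq_zero_or_mem_of_mul_mem (sub_mem (hFK a') (hFK a)) h).elim
        (left_ne_zero_of_mul h0) hx
  intro b c d e hb hd he hbe
  by_cases hb0 : b = 0
  · exact ⟨0, by simp [hb0]⟩
  obtain ⟨hb, hd⟩ := hold _ _ _ _ hb hd (by simp) (by simp)
  obtain ⟨he, hbe⟩ := hold _ _ _ _ he hbe (by simpa using hSK _ hb) (by simpa using hb0)
  exact hgen b c d e hb hd he hbe

/-! ### Back and forth -/

variable (ι) in
/-- The generic partial `F`-isomorphisms, ordered by inclusion. -/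
def GenericPartialIso : Type u := {S : Set (R × R) // IsPartialIso ι S ∧ IsGeneric ι S}

instance : PartialOrder (GenericPartialIso ι) := Subtype.partialOrder _

theorem isPartialIso_lines_one : IsPartialIso ι (lines ι {(1, 1)}) where
  one_mem := subset_lines _ rfl
  exists_lines := ⟨_, Set.finite_singleton _, rfl⟩
  lt_iff := by
    rintro _ ⟨a, _, rfl, rfl⟩ _ ⟨b, _, rfl, rfl⟩
    rfl

theorem isGeneric_lines_one : IsGeneric ι (lines ι {(1, 1)}) := by
  rintro b c d e ⟨a, _, rfl, h⟩ - - -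
  exact ⟨a, by simpa using (Prod.ext_iff.1 h).1.symm⟩

variable (ι) in
/-- The least generic partial `F`-isomorphism, the identity of `F`. -/
def GenericPartialIso.base : GenericPartialIso ι :=
  ⟨lines ι {(1, 1)}, isPartialIso_lines_one, isGeneric_lines_one⟩

variable [IsStrictOrderedRing R]

/-- The cut of a new element of the domain is realized by all elements of some interval. -/
theorem IsSaturatedExtension.exists_cut (hι : IsSaturatedExtension ι) {S : Set (R × R)}
    (hS : IsPartialIso ι S) (x : R) :
    ∃ u v, u < v ∧ ∀ y, u < y → y < v → ∀ p ∈ S, (p.1 < x → p.2 < y) ∧ (x < p.1 → y < p.2) := by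
  obtain ⟨T, hT, rfl⟩ := hS.exists_lines
  obtain ⟨N, hN⟩ := hι.exists_bound (hT.image Prod.snd)
  have hN' : ∀ z ∈ adjoin ι (Prod.snd '' T), -N < z := fun z hz => by
    linarith [hN _ (neg_mem hz)]
  have hN0 : 0 < N := hN 0 (Subfield.zero_mem _)
  have hmem : ∀ (a : F), ∀ q ∈ T, ι a * q.2 ∈ adjoin ι (Prod.snd '' T) := fun a q hq =>
    mul_mem (map_mem_adjoin a) (mem_adjoin ⟨q, hq, rfl⟩)
  obtain ⟨k, q, -, hq⟩ := hT.fin_param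
  -- multiples on the wrong side of `x` are replaced by values beyond all multiples
  have hlow : ∀ i, IsDefinableFun Set.univ
      fun v : Fin 1 → R => if v 0 * (q i).1 < x then v 0 * (q i).2 else -N := fun i =>
    .ite_lt (.mul (isDefinableFun_proj 0) (isDefinableFun_const trivial))
      (isDefinableFun_const trivial)
      (.mul (isDefinableFun_proj 0) (isDefinableFun_const trivial)) (isDefinableFun_const trivial)
  have hupp : ∀ i, IsDefinableFun Set.univ
      fun v : Fin 1 → R => if x < v 0 * (q i).1 then v 0 * (q i).2 else N := fun i =>
    .ite_lt (isDefinableFun_const trivial)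
      (.mul (isDefinableFun_proj 0) (isDefinableFun_const trivial))
      (.mul (isDefinableFun_proj 0) (isDefinableFun_const trivial)) (isDefinableFun_const trivial)
  have hqT : ∀ i, q i ∈ T := fun i => hq ▸ Set.mem_range_self i
  obtain ⟨u, hu, v, hv, huv⟩ := (hι.interval k k (fun _ => 1) (fun _ => 1) _ _ hlow hupp
    (by
      intro i j a b
      dsimp only
      split_ifs with h1 h2 h2
      · exact (hS.lt_iff _ ⟨a 0, q i, hqT i, rfl⟩ _ ⟨b 0, q j, hqT j, rfl⟩).1 (h1.trans h2)
      · exact hN _ (hmem _ _ (hqT i))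
      · exact hN' _ (hmem _ _ (hqT j))
      · linarith)).exists_lt
  refine ⟨u, v, huv, ?_⟩
  rintro y hy1 hy2 _ ⟨a, p, hp, rfl⟩
  rw [← hq] at hp
  obtain ⟨i, rfl⟩ := hp
  constructor
  · intro h
    have := hu.1 i (fun _ => a)
    rw [if_pos h] at this
    exact this.trans hy1
  · intro h
    have := hv.2 i (fun _ => a)
    rw [if_pos h] at this
    exact hy2.trans this

theorem IsSaturatedExtension.exists_mem_left (hι : IsSaturatedExtension ι)
    (S : GenericPartialIso ι) (x : R) : ∃ S', S ≤ S' ∧ ∃ y, (x, y) ∈ S'.1 := by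
  obtain ⟨S, hS, hgen⟩ := S
  by_cases hx : ∃ y, (x, y) ∈ S
  · exact ⟨_, le_rfl, hx⟩
  obtain ⟨u, v, huv, hcut⟩ := hι.exists_cut hS x
  obtain ⟨A, hA, hSA⟩ := hS.exists_finite_adjoin
  obtain ⟨y, hy1, hy2, hyA⟩ := hι.exists_sq_notMem hA huv
  replace hcut := hcut y hy1 hy2
  have hne : ∀ p ∈ S, p.1 ≠ x := fun p hp h => hx ⟨p.2, h ▸ hp⟩
  refine ⟨⟨S ∪ lines ι {(x, y)}, hS.union_lines (fun p hp => ⟨(hcut p hp).1, fun h => ?_⟩)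
    (fun p hp => ⟨(hcut p hp).2, fun h => ?_⟩), hgen.union_lines_of_sq_notMem hS map_mem_adjoin
    (fun p hp => (hSA p hp).2) hyA⟩, Set.subset_union_left, y, Or.inr (subset_lines _ rfl)⟩
  · exact (hne p hp).lt_of_le (not_lt.1 fun h' => h.not_gt ((hcut p hp).2 h'))
  · exact (hne p hp).symm.lt_of_le (not_lt.1 fun h' => h.not_gt ((hcut p hp).1 h'))

theorem IsSaturatedExtension.exists_mem_right (hι : IsSaturatedExtension ι)
    (S : GenericPartialIso ι) (y : R) : ∃ S', S ≤ S' ∧ ∃ x, (x, y) ∈ S'.1 := by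
  obtain ⟨S, hS, hgen⟩ := S
  by_cases hy : ∃ x, (x, y) ∈ S
  · exact ⟨_, le_rfl, hy⟩
  obtain ⟨u, v, huv, hcut⟩ := hι.exists_cut hS.image_swap y
  obtain ⟨A, hA, hSA⟩ := hS.exists_finite_adjoin
  obtain ⟨x, hx1, hx2, hxA⟩ := hι.exists_sq_notMem hA huv
  replace hcut : ∀ p ∈ S, (p.2 < y → p.1 < x) ∧ (y < p.2 → x < p.1) := fun p hp =>
    hcut x hx1 hx2 p.swap ⟨p, hp, rfl⟩
  have hne : ∀ p ∈ S, p.2 ≠ y := fun p hp h => hy ⟨p.1, h ▸ hp⟩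
  refine ⟨⟨S ∪ lines ι {(x, y)}, hS.union_lines (fun p hp => ⟨fun h => ?_, (hcut p hp).1⟩)
    (fun p hp => ⟨fun h => ?_, (hcut p hp).2⟩), hgen.union_lines_of_notMem hS map_mem_adjoin
    (fun p hp => (hSA p hp).1) fun h => hxA (pow_mem h 2)⟩, Set.subset_union_left, x,
    Or.inr (subset_lines _ rfl)⟩
  · exact (hne p hp).lt_of_le (not_lt.1 fun h' => h.not_gt ((hcut p hp).2 h'))
  · exact (hne p hp).symm.lt_of_le (not_lt.1 fun h' => h.not_gt ((hcut p hp).1 h'))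

/-- An ideal of generic partial isomorphisms that meets each of the countably many extension
requirements yields an `F`-bijection `h` for which `b ⊗ (1 + b) = b + b ⊗ b` holds in `h⁻¹[R]`
only if `b` is in `F`. -/
theorem IsSaturatedExtension.exists_isFBijection (hι : IsSaturatedExtension ι) :
    ∃ h : R ≃o R, IsFBijection ι h ∧
      ∀ b, h b * h (1 + b) = h (b + h.symm (h b ^ 2)) → b ∈ Set.range ι := by
  have := hι.countable
  obtain ⟨_⟩ := nonempty_encodable R
  let D : R ⊕ R → Order.Cofinal (GenericPartialIso ι) := Sum.elim
    (fun x => ⟨{S | ∃ y, (x, y) ∈ S.1}, fun S => (hι.exists_mem_left S x).imp fun _ h => h.symm⟩)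
    (fun y => ⟨{S | ∃ x, (x, y) ∈ S.1}, fun S => (hι.exists_mem_right S y).imp fun _ h => h.symm⟩)
  let I := Order.idealOfCofinals (GenericPartialIso.base ι) D
  have hleft : ∀ x, ∃ y, ∃ S ∈ I, (x, y) ∈ S.1 := fun x => by
    obtain ⟨S, ⟨y, hy⟩, hS⟩ := Order.cofinal_meets_idealOfCofinals _ D (Sum.inl x)
    exact ⟨y, S, hS, hy⟩
  have hright : ∀ y, ∃ x, ∃ S ∈ I, (x, y) ∈ S.1 := fun y => by
    obtain ⟨S, ⟨x, hx⟩, hS⟩ := Order.cofinal_meets_idealOfCofinals _ D (Sum.inr y)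
    exact ⟨x, S, hS, hx⟩
  choose f hf using hleft
  choose g hg using hright
  have hlt : ∀ x y x' y', (∃ S ∈ I, (x, y) ∈ S.1) → (∃ S ∈ I, (x', y') ∈ S.1) →
      (x < x' ↔ y < y') := by
    rintro x y x' y' ⟨S, hS, h⟩ ⟨S', hS', h'⟩
    obtain ⟨U, -, hSU, hSU'⟩ := I.directed S hS S' hS'
    exact U.2.1.lt_iff _ (hSU h) _ (hSU' h')
  have heq : ∀ x y x' y', (∃ S ∈ I, (x, y) ∈ S.1) → (∃ S ∈ I, (x', y') ∈ S.1) →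
      (x = x' ↔ y = y') := by
    intro x y x' y' h h'
    rw [le_antisymm_iff, le_antisymm_iff, ← not_lt, ← not_lt, ← not_lt, ← not_lt,
      hlt _ _ _ _ h h', hlt _ _ _ _ h' h]
  let h : R ≃o R :=
    { toFun := f
      invFun := g
      left_inv := fun x => (heq _ _ _ _ (hg _) (hf x)).2 rfl
      right_inv := fun y => (heq _ _ _ _ (hf _) (hg y)).1 rfl
      map_rel_iff' := fun {x x'} => by
        change f x ≤ f x' ↔ x ≤ x'
        rw [← not_lt, ← not_lt, hlt _ _ _ _ (hf x') (hf x)] }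
  have hgraph : ∀ x y, (∃ S ∈ I, (x, y) ∈ S.1) → h x = y := fun x y hxy =>
    (heq _ _ _ _ (hf x) hxy).1 rfl
  have hbase := Order.mem_idealOfCofinals (GenericPartialIso.base ι) D
  refine ⟨h, ⟨hgraph _ _ ⟨_, hbase, isPartialIso_lines_one.zero_mem⟩,
    hgraph _ _ ⟨_, hbase, isPartialIso_lines_one.one_mem⟩, fun a x => ?_⟩, fun b hb => ?_⟩
  · obtain ⟨S, hS, hx⟩ := hf x
    exact hgraph _ _ ⟨S, hS, S.2.1.smul_mem hx a⟩
  · obtain ⟨S₁, hS₁, h₁⟩ := hf b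
    obtain ⟨S₂, hS₂, h₂⟩ := hf (1 + b)
    obtain ⟨S₃, hS₃, h₃⟩ := hg (h b ^ 2)
    obtain ⟨S₄, hS₄, h₄⟩ := hf (b + h.symm (h b ^ 2))
    obtain ⟨U, hU, h1U, h2U⟩ := I.directed S₁ hS₁ S₂ hS₂
    obtain ⟨V, hV, h3V, h4V⟩ := I.directed S₃ hS₃ S₄ hS₄
    obtain ⟨W, -, hUW, hVW⟩ := I.directed U hU V hV
    refine W.2.2 b (h b) (h (1 + b)) (h.symm (h b ^ 2)) (hUW (h1U h₁)) (hUW (h2U h₂))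
      (hVW (h3V h₃)) ?_
    rw [hb]
    exact hVW (h4V h₄)

end PartialIso

/-! ### The structure `h⁻¹[R]` -/

section Model

variable {F : Subfield ℝ} {R : Type u}

section Realize

variable [M : (starLang F).Structure R] {n : ℕ} (v : Empty ⊕ Fin n → R)

theorem realize_tzero :
    (tzero : Tm F n).realize v = M.funMap (n := 0) StarFunc.zero default :=
  Term.realize_constants

theorem realize_tone : (tone : Tm F n).realize v = M.funMap (n := 0) StarFunc.one default :=
  Term.realize_constants

theorem realize_tconst (a : F) :
    (tconst a : Tm F n).realize v = M.funMap (n := 0) (StarFunc.const a) default :=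
  Term.realize_constants

theorem realize_tadd (s t : Tm F n) :
    (tadd s t).realize v = M.funMap (n := 2) StarFunc.add ![s.realize v, t.realize v] :=
  Term.realize_functions_apply₂

theorem realize_tmul (s t : Tm F n) :
    (tmul s t).realize v = M.funMap (n := 2) StarFunc.mul ![s.realize v, t.realize v] :=
  Term.realize_functions_apply₂

theorem realize_tlt (s t : Tm F n) (w : Empty → R) (xs : Fin n → R) :
    (tlt s t).Realize w xs ↔ M.RelMap (n := 2) StarRel.lt
      ![s.realize (Sum.elim w xs), t.realize (Sum.elim w xs)] :=
  BoundedFormula.realize_rel₂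

end Realize

variable [Field R] [LinearOrder R] {ι : F →+*o R} {h : R ≃o R}

theorem sameAddOrder_hInv : SameAddOrder (hInv ι h) :=
  ⟨fun _ => rfl, fun _ => rfl, fun _ _ => rfl, fun _ _ => Iff.rfl⟩

theorem mulIn_hInv (x y : R) : mulIn (hInv ι h) x y = h.symm (h x * h y) := rfl

theorem IsFBijection.pos_iff (hh : IsFBijection ι h) {x : R} : 0 < h x ↔ 0 < x := by
  rw [← hh.1, h.lt_iff_lt, hh.1]

theorem IsFBijection.apply_map (hh : IsFBijection ι h) (a : F) : h (ι a) = ι a := by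
  simpa [hh.2.1] using hh.2.2 a 1

theorem IsFBijection.symm_map_mul (hh : IsFBijection ι h) (a : F) (x : R) :
    h.symm (ι a * h x) = ι a * x := by
  rw [← hh.2.2, h.symm_apply_apply]

variable [IsStrictOrderedRing R]

theorem IsFBijection.model_hInv (hι : IsSaturatedExtension ι)
    (hh : IsFBijection ι h) : let _ := hInv ι h; (starTheory F).Model R := by
  intro M
  have hmul : ∀ (a : F) (x : R), h.symm (ι a * h x) = ι a * x := hh.symm_map_mul
  have hF := hh.apply_map
  have hpos : ∀ {x}, 0 < x → 0 < h x := hh.pos_iff.2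
  have hspos : ∀ {x}, 0 < x → 0 < h.symm x := fun {x} hx => by
    rwa [← hh.pos_iff, h.apply_symm_apply]
  have := hι.realClosed
  have f0 : ∀ v, M.funMap (n := 0) StarFunc.zero v = 0 := fun _ => rfl
  have f1 : ∀ v, M.funMap (n := 0) StarFunc.one v = 1 := fun _ => rfl
  have fc : ∀ a v, M.funMap (n := 0) (StarFunc.const a) v = ι a := fun _ _ => rfl
  have fa : ∀ x y, M.funMap (n := 2) StarFunc.add ![x, y] = x + y := fun _ _ => rfl
  have fm : ∀ x y, M.funMap (n := 2) StarFunc.mul ![x, y] = h.symm (h x * h y) := fun _ _ => rfl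
  have fl : ∀ x y, M.RelMap (n := 2) StarRel.lt ![x, y] ↔ x < y := fun _ _ => Iff.rfl
  have fp : ∀ (n : ℕ) (v : Empty ⊕ Fin n → R) (t : Tm F n) (k : ℕ),
      (tpow t k).realize v = h.symm (h (t.realize v) ^ k) := by
    intro n v t k
    induction k with
    | zero => rw [tpow, realize_tone, f1, pow_zero, eq_comm, h.symm_apply_eq, hh.2.1]
    | succ k ih => rw [tpow, realize_tmul, fm, ih, h.apply_symm_apply, pow_succ]
  refine ⟨fun φ hφ => ?_⟩
  change StarAxiom F φ at hφ
  -- the remaining goals are the axioms about `R`, up to the evaluation of `Fin.snoc`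
  cases hφ <;>
    simp only [Sentence.Realize, Formula.Realize, BoundedFormula.realize_all,
      BoundedFormula.realize_ex, BoundedFormula.realize_imp, BoundedFormula.realize_inf,
      BoundedFormula.realize_sup, BoundedFormula.realize_not, BoundedFormula.realize_bdEqual,
      realize_tlt, realize_tadd, realize_tmul, realize_tzero, realize_tone, realize_tconst,
      fp, f0, f1, fc, fa, fm, fl]
  case add_assoc => exact fun x y z => add_assoc x y z
  case add_comm => exact fun x y => add_comm x y
  case zero_add => exact fun x => zero_add x
  case exists_neg => exact fun x => ⟨-x, add_neg_cancel x⟩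
  case lt_irrefl => exact fun x => lt_irrefl x
  case lt_trans => exact fun x y z => lt_trans (a := x) (b := y) (c := z)
  case lt_total => exact fun x y => lt_trichotomy x y
  case add_lt_add => exact fun x y z hxy => add_lt_add_left (a := z) (b := x) (c := y) hxy
  case one_pos => exact one_pos
  case mul_pos => exact fun x y hx hy => hspos (mul_pos (hpos hx) (hpos hy))
  case mul_assoc =>
    intro x y z _ _ _
    change h.symm (h (h.symm (h x * h y)) * h z) = h.symm (h x * h (h.symm (h y * h z)))
    rw [h.apply_symm_apply, h.apply_symm_apply, mul_assoc]
  case mul_comm => exact fun x y _ _ => congrArg h.symm (mul_comm (h x) (h y))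
  case one_mul =>
    intro x _
    change h.symm (h 1 * h x) = x
    rw [hh.2.1, one_mul, h.symm_apply_apply]
  case exists_inv =>
    intro x (hx : 0 < x)
    refine ⟨h.symm (h x)⁻¹, hspos (inv_pos.2 (hpos hx)), ?_⟩
    change h.symm (h x * h (h.symm (h x)⁻¹)) = 1
    rw [h.apply_symm_apply, mul_inv_cancel₀ (hpos hx).ne', h.symm_apply_eq, hh.2.1]
  case mul_lt_mul =>
    intro x y z _ _ hz hxy
    exact h.symm.strictMono (mul_lt_mul_of_pos_right (h.strictMono hxy) (hpos hz))
  case divisible k hk =>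
    intro x (hx : 0 < x)
    obtain ⟨r, hr⟩ := IsRealClosed.exists_eq_pow_of_isSquare (x := h x)
      ((IsRealClosed.isSquare_or_isSquare_neg (h x)).resolve_right fun ⟨s, hs⟩ => by
        have := hpos hx
        have := mul_self_nonneg s
        linarith) hk.ne'
    -- `r` may be negative if `k` is even, but then `|r|` is a root too
    have hr' : h x = |r| ^ k := by rw [← abs_pow, ← hr, abs_of_pos (hpos hx)]
    have hr0 : 0 < |r| := abs_pos.2 fun h0 => by
      rw [h0, zero_pow hk.ne'] at hr
      exact (hpos hx).ne' hr
    refine ⟨h.symm |r|, hspos hr0, ?_⟩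
    change h.symm (h (h.symm |r|) ^ k) = x
    rw [h.apply_symm_apply, ← hr', h.symm_apply_apply]
  case const_add a b => exact map_add ι a b
  case const_mul a b => rw [hF a, hmul, map_mul]
  case const_pos a ha =>
    have := ι.monotone'.strictMono_of_injective ι.toRingHom.injective ha
    rwa [← map_zero ι]
  case const_add_mul a b =>
    intro x
    change h.symm (h (ι (a + b)) * h x) = h.symm (h (ι a) * h x) + h.symm (h (ι b) * h x)
    rw [hF, hF, hF, hmul, hmul, hmul, map_add, add_mul]
  case const_mul_add a =>
    intro x y
    change h.symm (h (ι a) * h (x + y)) = h.symm (h (ι a) * h x) + h.symm (h (ι a) * h y)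
    rw [hF, hmul, hmul, hmul, mul_add]

omit [IsStrictOrderedRing R] in
/-- In `h⁻¹[R]`, multiplication by elements of `F` is that of `R`, so it distributes over sums. -/
theorem IsFBijection.distrib_of_map (hh : IsFBijection ι h) (a : F) :
    mulIn (hInv ι h) (ι a) (1 + ι a) = ι a + mulIn (hInv ι h) (ι a) (ι a) := by
  have e : ∀ x, mulIn (hInv ι h) (ι a) x = ι a * x := fun x => by
    rw [mulIn_hInv, hh.apply_map, hh.symm_map_mul]
  rw [e, e, mul_add, mul_one]

end Model

/-! ### Hyperreal numbers -/

section Hyperreal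

open Filter Polynomial

/-- The ultrapower of `ℝ` by a nonprincipal ultrafilter on `ℕ`. -/
abbrev UltraReal : Type := Germ ((hyperfilter ℕ : Ultrafilter ℕ) : Filter ℕ) ℝ

/-- The ultrapower is an `η₁`-set. An element between `C` and `D` is obtained by a diagonal
argument: its `n`-th term separates the `n`-th terms of the first `k` elements of `C` and of `D`,
where `k ≤ n` is as large as possible. -/
theorem UltraReal.exists_between {C D : Set UltraReal} (hC : C.Countable) (hD : D.Countable)
    (h : ∀ c ∈ C, ∀ d ∈ D, c < d) : ∃ x, (∀ c ∈ C, c < x) ∧ ∀ d ∈ D, x < d := by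
  classical
  have hrep : ∀ c : UltraReal, ∃ f : ℕ → ℝ, (f : UltraReal) = c := fun c =>
    Germ.inductionOn c fun f => ⟨f, rfl⟩
  choose r hr using hrep
  have := hC.to_subtype
  have := hD.to_subtype
  obtain ⟨e, he⟩ := exists_surjective_nat (Option C)
  obtain ⟨e', he'⟩ := exists_surjective_nat (Option D)
  let Q : ℕ → ℕ → ℕ → Prop := fun i j n => ∀ c : C, e i = some c → ∀ d : D, e' j = some d → r c n < r d n
  have hQ : ∀ i j, ∀ᶠ n in (hyperfilter ℕ : Filter ℕ), Q i j n := by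
    intro i j
    cases hi : e i with
    | none => simp [Q, hi]
    | some c =>
      cases hj : e' j with
      | none => simp [Q, hj]
      | some d =>
        have := h c c.2 d d.2
        rw [← hr c, ← hr d, Germ.coe_lt] at this
        simp only [Q, hi, hj, Option.some.injEq]
        filter_upwards [this] with n hn c' hc d' hd
        rwa [← hc, ← hd]
  let P : ℕ → ℕ → Prop := fun n k => ∀ i < k, ∀ j < k, Q i j n
  have hP : ∀ k, ∀ᶠ n in (hyperfilter ℕ : Filter ℕ), k ≤ Nat.findGreatest (P n) n := by
    intro k
    have h1 : ∀ᶠ n in (hyperfilter ℕ : Filter ℕ), P n k :=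
      (Set.finite_Iio k).eventually_all.2 fun i _ =>
        (Set.finite_Iio k).eventually_all.2 fun j _ => hQ i j
    filter_upwards [h1, Nat.hyperfilter_le_atTop (eventually_ge_atTop k)] with n hn hk
    exact Nat.le_findGreatest hk hn
  have hPn : ∀ n, P n (Nat.findGreatest (P n) n) := fun n =>
    Nat.findGreatest_spec (m := 0) (Nat.zero_le n) (by simp [P])
  let lo : ℕ → Finset ℝ := fun n => (Finset.range (Nat.findGreatest (P n) n)).biUnion
    fun i => (e i).toFinset.image fun c : C => r c n
  let up : ℕ → Finset ℝ := fun n => (Finset.range (Nat.findGreatest (P n) n)).biUnion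
    fun i => (e' i).toFinset.image fun d : D => r d n
  have hx : ∀ n, ∃ x : ℝ, (∀ y ∈ lo n, y < x) ∧ ∀ y ∈ up n, x < y := by
    refine fun n => Order.exists_between_finsets _ _ fun y hy z hz => ?_
    simp only [lo, up, Finset.mem_biUnion, Finset.mem_range, Finset.mem_image,
      Option.mem_toFinset, Option.mem_def] at hy hz
    obtain ⟨i, hi, c, hc, rfl⟩ := hy
    obtain ⟨j, hj, d, hd, rfl⟩ := hz
    exact hPn n i hi j hj c hc d hd
  choose x hx1 hx2 using hx
  refine ⟨(x : UltraReal), fun c hc => ?_, fun d hd => ?_⟩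
  · obtain ⟨i, hi⟩ := he (some ⟨c, hc⟩)
    rw [← hr c, Germ.coe_lt]
    filter_upwards [hP (i + 1)] with n hn
    refine hx1 n _ ?_
    simp only [lo, Finset.mem_biUnion, Finset.mem_range, Finset.mem_image, Option.mem_toFinset,
      Option.mem_def]
    exact ⟨i, hn, _, hi, rfl⟩
  · obtain ⟨i, hi⟩ := he' (some ⟨d, hd⟩)
    rw [← hr d, Germ.coe_lt]
    filter_upwards [hP (i + 1)] with n hn
    refine hx2 n _ ?_
    simp only [up, Finset.mem_biUnion, Finset.mem_range, Finset.mem_image, Option.mem_toFinset,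
      Option.mem_def]
    exact ⟨i, hn, _, hi, rfl⟩

theorem exists_isRoot_real {p : ℝ[X]} (hp : Odd p.natDegree) : ∃ x, p.IsRoot x := by
  wlog hlc : 0 ≤ p.leadingCoeff generalizing p
  · obtain ⟨x, hx⟩ := this (p := -p) (by simpa using hp) (by simpa using (not_le.1 hlc).le)
    exact ⟨x, by simpa using hx⟩
  have hdeg : 0 < p.degree := natDegree_pos_iff_degree_pos.1 hp.pos
  have htop := p.tendsto_atTop_of_leadingCoeff_nonneg hdeg hlc
  have hcomp : (p.comp (-X)).natDegree = p.natDegree := by simp [natDegree_comp]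
  have hbot := (p.comp (-X)).tendsto_atBot_of_leadingCoeff_nonpos
    (natDegree_pos_iff_degree_pos.1 (hcomp ▸ hp.pos)) (by
      rw [leadingCoeff_comp (by simp)]
      simpa [hp.neg_one_pow] using hlc)
  obtain ⟨a, ha⟩ := (htop.eventually_ge_atTop 0).exists
  obtain ⟨b, hb⟩ := (hbot.eventually_le_atBot 0).exists
  rw [eval_comp] at hb
  exact mem_range_of_exists_le_of_exists_ge p.continuous ⟨_, hb⟩ ⟨a, ha⟩

theorem UltraReal.isRealClosed : IsRealClosed UltraReal := by
  refine .of_linearOrderedField (fun {x} => ?_) (fun {p} hp => ?_)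
  · refine Germ.inductionOn x fun f hf => ⟨((fun n => √(f n) : ℕ → ℝ) : UltraReal), ?_⟩
    rw [← Germ.coe_mul, Germ.coe_eq]
    have hf' : ∀ᶠ n in (hyperfilter ℕ : Filter ℕ), 0 ≤ f n := Germ.coe_le.1 hf
    filter_upwards [hf'] with n hn
    exact (Real.mul_self_sqrt hn).symm
  · have hrep : ∀ c : UltraReal, ∃ f : ℕ → ℝ, (f : UltraReal) = c := fun c =>
      Germ.inductionOn c fun f => ⟨f, rfl⟩
    choose r hr using hrep
    set d := p.natDegree with hd
    -- a root is obtained termwise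
    let q : ℕ → ℝ[X] := fun n => ∑ i ∈ Finset.range (d + 1), C (r (p.coeff i) n) * X ^ i
    have hroot : ∀ᶠ n in (hyperfilter ℕ : Filter ℕ), ∃ x, (q n).IsRoot x := by
      have hlead : p.coeff d ≠ 0 := by
        rw [hd, coeff_natDegree, leadingCoeff_ne_zero]
        rintro rfl
        simp [hd] at hp
      have : ∀ᶠ n in (hyperfilter ℕ : Filter ℕ), r (p.coeff d) n ≠ 0 := by
        rw [Ultrafilter.eventually_not]
        intro h0
        exact hlead ((hr _).symm.trans (Germ.coe_eq.2 h0))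
      filter_upwards [this] with n hn
      refine exists_isRoot_real ?_
      have hcoeff : ∀ j, (q n).coeff j = if j < d + 1 then r (p.coeff j) n else 0 := fun j => by
        simp [q, coeff_X_pow]
      have : (q n).natDegree = d := natDegree_eq_of_le_of_coeff_ne_zero
        (natDegree_le_iff_coeff_eq_zero.2 fun j hj => by rw [hcoeff, if_neg (by omega)])
        (by rwa [hcoeff, if_pos (by omega)])
      rwa [this]
    choose! x hx using fun n (h : ∃ x, (q n).IsRoot x) => h
    refine ⟨(x : UltraReal), ?_⟩
    have hsum : ((fun n => (q n).eval (x n) : ℕ → ℝ) : UltraReal) = p.eval (x : UltraReal) := by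
      rw [eval_eq_sum_range]
      have : (fun n => (q n).eval (x n)) =
          ∑ i ∈ Finset.range (d + 1), r (p.coeff i) * x ^ i := by
        ext n
        simp [q, eval_finsetSum]
      rw [this, ← Germ.coe_coeRingHom, map_sum]
      refine Finset.sum_congr rfl fun i _ => ?_
      rw [map_mul, map_pow, Germ.coe_coeRingHom, hr]
    rw [IsRoot.def, ← hsum]
    exact Germ.coe_eq.2 (hroot.mono hx)

end Hyperreal

/-! ### Countable closed subsets -/

/-- The Löwenheim–Skolem argument: given countably many conditions on a tuple of parameters and a
pair of elements, every countable set is contained in a countable set in which each condition is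
satisfiable if it is satisfiable in `M`. -/
theorem exists_countable_closed {M : Type u} {I : Type*} [Countable I] (ar : I → ℕ)
    (Q : ∀ i, (Fin (ar i) → M) → M → M → Prop) {s : Set M} (hs : s.Countable) :
    ∃ S : Set M, S.Countable ∧ s ⊆ S ∧
      ∀ i v, (∀ j, v j ∈ S) → (∃ x y, Q i v x y) → ∃ x ∈ S, ∃ y ∈ S, Q i v x y := by
  classical
  rcases isEmpty_or_nonempty M with _ | _
  · exact ⟨s, hs, subset_rfl, fun i v _ ⟨x, _⟩ => isEmptyElim x⟩
  have hex : ∀ i v, ∃ p : M × M, (∃ x y, Q i v x y) → Q i v p.1 p.2 := fun i v => by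
    by_cases h : ∃ x y, Q i v x y
    · obtain ⟨x, y, h⟩ := h
      exact ⟨(x, y), fun _ => h⟩
    · exact ⟨Classical.arbitrary _, fun h' => absurd h' h⟩
  choose op hop using hex
  let step : Set M → Set M := fun T => T ∪ ⋃ i, ⋃ w : Fin (ar i) → T,
    {(op i fun j => w j).1, (op i fun j => w j).2}
  have hstep : ∀ T : Set M, T.Countable → (step T).Countable := fun T hT => by
    have := hT.to_subtype
    exact hT.union (Set.countable_iUnion fun i => Set.countable_iUnion fun w =>
      (Set.toFinite _).countable)
  let T : ℕ → Set M := fun n => step^[n] s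
  have hT : ∀ n, T (n + 1) = step (T n) := fun n => Function.iterate_succ_apply' step n s
  have hmono : Monotone T := monotone_nat_of_le_succ fun n => by
    rw [hT]
    exact Set.subset_union_left
  refine ⟨⋃ n, T n, Set.countable_iUnion fun n => ?_, Set.subset_iUnion T 0, ?_⟩
  · induction n with
    | zero => exact hs
    | succ n ih =>
      rw [hT]
      exact hstep _ ih
  · intro i v hv hQ
    simp only [Set.mem_iUnion] at hv
    choose n hn using hv
    obtain ⟨N, hN⟩ := Finset.exists_le (Finset.univ.image n)
    have hvN : ∀ j, v j ∈ T N := fun j => hmono (hN _ (by simp)) (hn j)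
    have hmem : ({(op i v).1, (op i v).2} : Set M) ⊆ ⋃ n, T n := by
      refine subset_trans ?_ (Set.subset_iUnion T (N + 1))
      rw [hT]
      refine subset_trans ?_ Set.subset_union_right
      exact Set.subset_iUnion_of_subset i
        (Set.subset_iUnion_of_subset (fun j => ⟨v j, hvN j⟩) subset_rfl)
    exact ⟨_, hmem (by simp), _, hmem (by simp), hop i v hQ⟩

/-! ### Existence of saturated extensions -/

section Existence

attribute [local instance] ordRingStructure

variable {F : Subfield ℝ} {M : Type u} [Field M] [LinearOrder M]

/-- The values at tuples from `F` of the partial function whose graph is defined by `φ` with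
parameters `v`. The variable `none` stands for the value. -/
def valueSet (κ : F →+*o M) {p : ℕ} (φ : Σ n, ordRingLang.Formula (Fin p ⊕ Option (Fin n)))
    (v : Fin p → M) : Set M :=
  {y | ∃ a : Fin φ.1 → F, ∀ z,
    φ.2.Realize (Sum.elim v fun o => o.elim z fun i => κ (a i)) ↔ z = y}

theorem countable_valueSet [Countable F] (κ : F →+*o M) {p : ℕ}
    (φ : Σ n, ordRingLang.Formula (Fin p ⊕ Option (Fin n))) (v : Fin p → M) :
    (valueSet κ φ v).Countable := by
  have : valueSet κ φ v = ⋃ a : Fin φ.1 → F, {y | ∀ z,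
      φ.2.Realize (Sum.elim v fun o => o.elim z fun i => κ (a i)) ↔ z = y} := by
    ext y
    simp [valueSet]
  rw [this]
  refine Set.countable_iUnion fun a => Set.Subsingleton.countable fun y hy z hz => ?_
  exact (hz y).1 ((hy y).2 rfl)

/-- The inclusion of a subfield is an embedding for the language of ordered rings. -/
def subfieldEmbedding (K : Subfield M) : K ↪[ordRingLang] M where
  toFun := Subtype.val
  inj' := Subtype.val_injective
  map_fun' := by
    rintro n (f | f) x
    · cases f <;> rfl
    · exact f.elim
  map_rel' := by
    rintro n (r | r) x
    · exact r.elim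
    · cases r
      rfl

theorem isRealClosed_of_exists_root [IsStrictOrderedRing M] [IsRealClosed M] {K : Subfield M}
    (hK : ∀ (n : ℕ) (v : Fin n → M), (∀ i, v i ∈ K) → (∃ x, ∑ i, v i * x ^ (i : ℕ) = 0) →
      ∃ x ∈ K, ∑ i, v i * x ^ (i : ℕ) = 0) : IsRealClosed K := by
  refine .of_linearOrderedField (fun {x} hx => ?_) (fun {p} hp => ?_)
  · obtain ⟨y, hy⟩ : IsSquare (x : M) :=
      (IsRealClosed.isSquare_or_isSquare_neg (x : M)).elim id fun ⟨y, hy⟩ => by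
        have h1 : (0 : M) ≤ x := hx
        have h2 := mul_self_nonneg y
        exact ⟨0, by linarith⟩
    obtain ⟨z, hz, h⟩ := hK 3 ![-x, 0, 1]
      (by simp [Fin.forall_fin_succ])
      ⟨y, by simp [Fin.sum_univ_succ, hy, sq]⟩
    refine ⟨⟨z, hz⟩, Subtype.ext ?_⟩
    simp only [Fin.sum_univ_succ] at h
    simp at h
    change (x : M) = z * z
    linear_combination -h
  · have hroot : ∀ y : M, (p.map K.subtype).eval y =
        ∑ i : Fin (p.natDegree + 1), (p.coeff i : M) * y ^ (i : ℕ) := fun y => by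
      rw [Fin.sum_univ_eq_sum_range (fun i => (p.coeff i : M) * y ^ i), Polynomial.eval_map,
        Polynomial.eval₂_eq_sum_range]
      rfl
    obtain ⟨y, hy⟩ := IsRealClosed.exists_isRoot_of_odd_natDegree (f := p.map K.subtype)
      (by rwa [Polynomial.natDegree_map])
    rw [Polynomial.IsRoot.def, hroot] at hy
    obtain ⟨z, hz, h⟩ := hK (p.natDegree + 1) (fun i => p.coeff i) (fun i => (p.coeff i).2) ⟨y, hy⟩
    refine ⟨⟨z, hz⟩, K.subtype_injective ?_⟩
    rw [← hroot, Polynomial.eval_map] at h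
    change p.eval₂ K.subtype (K.subtype ⟨z, hz⟩) = 0 at h
    rwa [Polynomial.eval₂_hom, ← map_zero K.subtype] at h

variable [IsStrictOrderedRing M]

/-- A real closed `η₁`-field has a countable elementary subfield `K` that bounds and separates the
values of definable functions with parameters from `K`. -/
theorem exists_countable_elementary_subfield [IsRealClosed M] [Countable F] (κ : F →+*o M)
    (hM : ∀ C D : Set M, C.Countable → D.Countable → (∀ c ∈ C, ∀ d ∈ D, c < d) →
      ∃ x, (∀ c ∈ C, c < x) ∧ ∀ d ∈ D, x < d) :
    ∃ K : Subfield M, Countable K ∧ (∀ a, κ a ∈ K) ∧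
    IsRealClosed K ∧
    (∀ (n : ℕ) (φ : ordRingLang.BoundedFormula Empty (n + 1)) (v : Fin n → K) (a : M),
      φ.Realize default (Fin.snoc (Subtype.val ∘ v) a : Fin (n + 1) → M) →
      ∃ b : K, φ.Realize default (Fin.snoc (Subtype.val ∘ v) (b : M) : Fin (n + 1) → M)) ∧
    (∀ (p : ℕ) (v : Fin p → K), ∃ b : K, ∀ φ, ∀ y ∈ valueSet κ φ (Subtype.val ∘ v), y < b) ∧
    ∀ (p : ℕ) (s t : Finset (Σ n, ordRingLang.Formula (Fin p ⊕ Option (Fin n)))) (v : Fin p → K),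
      (∀ φ ∈ s, ∀ y ∈ valueSet κ φ (Subtype.val ∘ v), ∀ ψ ∈ t,
        ∀ z ∈ valueSet κ ψ (Subtype.val ∘ v), y < z) →
      ∃ b c : K, b < c ∧ (∀ φ ∈ s, ∀ y ∈ valueSet κ φ (Subtype.val ∘ v), y < b) ∧
        ∀ ψ ∈ t, ∀ z ∈ valueSet κ ψ (Subtype.val ∘ v), c < z := by
  let Φ : ℕ → Type := fun p => Σ n, ordRingLang.Formula (Fin p ⊕ Option (Fin n))
  -- one condition each for function symbols, roots, Skolem functions, bounds and gaps
  let I : Type := (Σ n, ordRingLang.Functions n) ⊕ ℕ ⊕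
    (Σ n, ordRingLang.BoundedFormula Empty (n + 1)) ⊕ ℕ ⊕ (Σ p, Finset (Φ p) × Finset (Φ p))
  have : Countable (Σ n, ordRingLang.BoundedFormula Empty (n + 1)) :=
    Function.Injective.countable (β := Σ n, ordRingLang.BoundedFormula Empty n)
      (f := fun φ => ⟨φ.1 + 1, φ.2⟩) (by
        rintro ⟨n, φ⟩ ⟨m, ψ⟩ h
        obtain ⟨h1, h2⟩ := Sigma.mk.inj_iff.1 h
        obtain rfl : n = m := by simpa using h1
        obtain rfl : φ = ψ := eq_of_heq h2
        rfl)
  have : Countable I := inferInstance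
  let ar : I → ℕ := Sum.elim (fun f => f.1) <| Sum.elim id <| Sum.elim (fun φ => φ.1) <|
    Sum.elim id fun q => q.1
  let Q : ∀ i : I, (Fin (ar i) → M) → M → M → Prop := fun i => match i with
    | .inl f => fun v x _ => x = Structure.funMap f.2 v
    | .inr (.inl _) => fun v x _ => ∑ i, v i * x ^ (i : ℕ) = 0
    | .inr (.inr (.inl φ)) => fun v x _ => φ.2.Realize default (Fin.snoc v x : Fin (φ.1 + 1) → M)
    | .inr (.inr (.inr (.inl _))) => fun v x _ => ∀ φ, ∀ y ∈ valueSet κ φ v, y < x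
    | .inr (.inr (.inr (.inr q))) => fun v x y => x < y ∧
        (∀ φ ∈ q.2.1, ∀ z ∈ valueSet κ φ v, z < x) ∧ ∀ φ ∈ q.2.2, ∀ z ∈ valueSet κ φ v, y < z
  obtain ⟨S, hS, hFS, hclosed⟩ := exists_countable_closed ar Q (Set.countable_range κ)
  have hfun : ∀ (n : ℕ) (f : ordRingLang.Functions n) (v : Fin n → M), (∀ i, v i ∈ S) →
      Structure.funMap f v ∈ S := fun n f v hv => by
    obtain ⟨x, hx, _, _, h⟩ := hclosed (.inl ⟨n, f⟩) v hv ⟨_, 0, rfl⟩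
    have h : x = Structure.funMap f v := h
    exact h ▸ hx
  have hroot : ∀ (n : ℕ) (v : Fin n → M), (∀ i, v i ∈ S) → (∃ x, ∑ i, v i * x ^ (i : ℕ) = 0) →
      ∃ x ∈ S, ∑ i, v i * x ^ (i : ℕ) = 0 := fun n v hv ⟨x, h⟩ => by
    obtain ⟨x, hx, _, _, h⟩ := hclosed (.inr (.inl n)) v hv ⟨x, 0, h⟩
    exact ⟨x, hx, h⟩
  have h0 : (0 : M) ∈ S := hfun 0 (.inl Ring.zeroFunc) ![] (by simp)
  have h1 : (1 : M) ∈ S := hfun 0 (.inl Ring.oneFunc) ![] (by simp)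
  have hneg : ∀ {x}, x ∈ S → -x ∈ S := fun {x} hx =>
    hfun 1 (.inl Ring.negFunc) ![x] (by simpa)
  let K : Subfield M :=
    { carrier := S
      zero_mem' := h0
      one_mem' := h1
      add_mem' := fun {x y} hx hy =>
        hfun 2 (.inl Ring.addFunc) ![x, y] (Fin.forall_fin_two.2 ⟨hx, hy⟩)
      mul_mem' := fun {x y} hx hy =>
        hfun 2 (.inl Ring.mulFunc) ![x, y] (Fin.forall_fin_two.2 ⟨hx, hy⟩)
      neg_mem' := hneg
      inv_mem' := fun x hx => by
        by_cases hx0 : x = 0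
        · rwa [hx0, inv_zero, ← hx0]
        -- `x⁻¹` is the root of `x * X - 1`
        obtain ⟨y, hy, h⟩ := hroot 2 ![-1, x] (Fin.forall_fin_two.2 ⟨hneg h1, hx⟩)
          ⟨x⁻¹, by simp [hx0]⟩
        have : x * y = 1 := by
          simp at h
          linear_combination h
        rwa [inv_eq_of_mul_eq_one_right this] }
  refine ⟨K, hS.to_subtype, fun a => hFS ⟨a, rfl⟩, isRealClosed_of_exists_root hroot, ?_, ?_, ?_⟩
  · intro n φ v a h
    obtain ⟨x, hx, _, _, h⟩ := hclosed (.inr (.inr (.inl ⟨n, φ⟩))) _ (fun j => (v j).2) ⟨a, 0, h⟩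
    exact ⟨⟨x, hx⟩, h⟩
  · intro p v
    obtain ⟨b, hb, -⟩ := hM (⋃ φ, valueSet κ φ (Subtype.val ∘ v)) ∅
      (Set.countable_iUnion fun φ => countable_valueSet κ φ _) Set.countable_empty (by simp)
    obtain ⟨x, hx, _, _, h⟩ := hclosed (.inr (.inr (.inr (.inl p)))) _ (fun j => (v j).2)
      ⟨b, 0, fun φ y hy => hb y (Set.mem_iUnion.2 ⟨φ, hy⟩)⟩
    exact ⟨⟨x, hx⟩, h⟩
  · intro p s t v h
    have hcount : ∀ s : Finset (Φ p), (⋃ φ ∈ s, valueSet κ φ (Subtype.val ∘ v)).Countable :=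
      fun s => s.countable_toSet.biUnion fun φ _ => countable_valueSet κ φ _
    obtain ⟨c, hc1, hc2⟩ := hM _ _ (hcount s) (hcount t) (by
      simp only [Set.mem_iUnion]
      rintro y ⟨φ, hφ, hy⟩ z ⟨ψ, hψ, hz⟩
      exact h φ hφ y hy ψ hψ z hz)
    obtain ⟨b, hb1, hb2⟩ := hM _ {c} (hcount s) (Set.countable_singleton c)
      (fun y hy z hz => hz ▸ hc1 y hy)
    obtain ⟨x, hx, y, hy, h⟩ := hclosed (.inr (.inr (.inr (.inr ⟨p, s, t⟩)))) _
      (fun j => (v j).2) ⟨b, c, hb2 c rfl, fun φ hφ z hz => hb1 z (by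
        simp only [Set.mem_iUnion]
        exact ⟨φ, hφ, hz⟩), fun φ hφ z hz => hc2 z (by
        simp only [Set.mem_iUnion]
        exact ⟨φ, hφ, hz⟩)⟩
    exact ⟨⟨x, hx⟩, ⟨y, hy⟩, h⟩

omit [IsStrictOrderedRing M] in
/-- In an elementary subfield, the value set of a formula that defines the graph of a function
consists of the values of this function. -/
theorem valueSet_eq_range {κ : F →+*o M} {K : Subfield M} {e : K ↪ₑ[ordRingLang] M}
    (he : ∀ x, e x = x) {ι : F →+*o K} (hι : ∀ a, (ι a : M) = κ a) {n p : ℕ}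
    {g : (Fin n → K) → K} {φ : ordRingLang.Formula (Fin p ⊕ Option (Fin n))} {w : Fin p → K}
    (hφ : ∀ v, φ.Realize (Sum.elim w v) ↔ g (v ∘ some) = v none) :
    valueSet κ ⟨n, φ⟩ (Subtype.val ∘ w) =
      Set.range fun a : Fin n → F => (g fun i => ι (a i) : M) := by
  have hK : ∀ (a : Fin n → F) (z : K), φ.Realize (Sum.elim (Subtype.val ∘ w)
      fun o : Option (Fin n) => o.elim (z : M) fun i => κ (a i)) ↔ g (fun i => ι (a i)) = z := by
    intro a z
    refine Iff.trans ?_ (hφ fun o => o.elim z fun i => ι (a i))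
    rw [← e.map_formula]
    refine iff_of_eq (congrArg _ (funext fun i => ?_))
    rcases i with i | _ | i <;> simp [he, hι]
  have huniq : ∀ (a : Fin n → F) (z : M), φ.Realize (Sum.elim (Subtype.val ∘ w)
      fun o : Option (Fin n) => o.elim z fun i => κ (a i)) → g (fun i => ι (a i)) = z := by
    intro a z hz
    by_contra hne
    -- a second solution in `M` would yield a second solution in `K`
    let σ : Fin p ⊕ Option (Fin n) → (Fin p ⊕ Option (Fin n)) ⊕ Fin 1 :=
      Sum.elim (Sum.inl ∘ Sum.inl) fun o => o.elim (Sum.inr 0) fun i => Sum.inl (Sum.inr (some i))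
    let ψ : ordRingLang.Formula ((Fin p ⊕ Option (Fin n)) ⊕ Fin 1) := φ.relabel σ ⊓
      ∼((Term.var (Sum.inl (Sum.inr none))).equal (Term.var (Sum.inr 0)))
    let u : Fin p ⊕ Option (Fin n) → K :=
      Sum.elim w fun o => o.elim (g fun i => ι (a i)) fun i => ι (a i)
    have hψ : (ψ.iExs (Fin 1)).Realize (e ∘ u) := by
      rw [Formula.realize_iExs]
      refine ⟨fun _ => z, ?_⟩
      simp only [ψ, Formula.realize_inf, Formula.realize_relabel, Formula.realize_not,
        Formula.realize_equal, Term.realize_var]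
      refine ⟨?_, by simpa [u, he] using hne⟩
      convert hz using 1
      ext i
      rcases i with i | _ | i <;> simp [σ, u, he, hι]
    rw [e.map_formula, Formula.realize_iExs] at hψ
    obtain ⟨z', h⟩ := hψ
    simp only [ψ, Formula.realize_inf, Formula.realize_relabel, Formula.realize_not,
      Formula.realize_equal, Term.realize_var] at h
    refine h.2 ?_
    have h1 := (hφ fun o => o.elim (z' 0) fun i => ι (a i)).1 (by
      convert h.1 using 1
      ext i
      rcases i with i | _ | i <;> simp [σ, u])
    exact h1
  ext y
  constructor
  · rintro ⟨a, ha⟩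
    exact ⟨a, (ha _).1 ((hK a _).2 rfl)⟩
  · rintro ⟨a, rfl⟩
    exact ⟨a, fun z => ⟨fun hz => (huniq a z hz).symm, fun hz => hz ▸ (hK a _).2 rfl⟩⟩

omit [IsStrictOrderedRing M] in
theorem exists_formula_of_isDefinableFun {A : Set M} {p : ℕ} {w : Fin p → M}
    (hw : A ⊆ Set.range w) {n : ℕ} {g : (Fin n → M) → M} (hg : IsDefinableFun A g) :
    ∃ φ : ordRingLang.Formula (Fin p ⊕ Option (Fin n)),
      ∀ v, φ.Realize (Sum.elim w v) ↔ g (v ∘ some) = v none := by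
  obtain ⟨φ, hφ⟩ := Set.definable_iff_exists_formula_sum.1 hg
  choose s hs using fun a : A => hw a.2
  refine ⟨φ.relabel (Sum.map s id), fun v => ?_⟩
  rw [Formula.realize_relabel, Sum.elim_comp_map, Function.comp_id]
  have h1 : v ∈ Function.tupleGraph g ↔ φ.Realize (Sum.elim (↑) v) := by
    rw [hφ]
    rfl
  have h2 : w ∘ s = Subtype.val := funext hs
  rw [h2, ← h1]
  rfl

omit [IsStrictOrderedRing M] in
/-- Finitely many definable functions are definable over a common finite set. -/
theorem exists_finite_isDefinableFun {k : ℕ} {n : Fin k → ℕ} {g : ∀ i, (Fin (n i) → M) → M}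
    (hg : ∀ i, IsDefinableFun Set.univ (g i)) :
    ∃ A : Set M, A.Finite ∧ ∀ i, IsDefinableFun A (g i) := by
  choose A _ hA using fun i => Set.definable_iff_finitely_definable.1 (hg i)
  exact ⟨⋃ i, A i, Set.finite_iUnion fun i => (A i).finite_toSet,
    fun i => IsDefinableFun.mono (hA i) (Set.subset_iUnion (fun i => (A i : Set M)) i)⟩

/-- Every real closed `η₁`-field that extends `F` contains a saturated extension of `F`. -/
theorem exists_isSaturatedExtension_subfield [IsRealClosed M] [Countable F] (κ : F →+*o M)
    (hM : ∀ C D : Set M, C.Countable → D.Countable → (∀ c ∈ C, ∀ d ∈ D, c < d) →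
      ∃ x, (∀ c ∈ C, c < x) ∧ ∀ d ∈ D, x < d) :
    ∃ (K : Subfield M) (ι : F →+*o K), IsSaturatedExtension ι := by
  classical
  obtain ⟨K, hcount, hF, hreal, helem, hbound, hgap⟩ :=
    exists_countable_elementary_subfield κ hM
  let e : K ↪ₑ[ordRingLang] M := (subfieldEmbedding K).toElementaryEmbedding helem
  have he : ∀ x, e x = x := fun _ => rfl
  let ι : F →+*o K :=
    { κ.toRingHom.codRestrict K hF with
      monotone' := fun a b hab => κ.monotone' hab }
  have hι : ∀ a, (ι a : M) = κ a := fun _ => rfl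
  refine ⟨K, ι, hcount, hreal, ?_, ?_⟩
  · intro A hA n g hg
    obtain ⟨p, w, -, rfl⟩ := hA.fin_param
    obtain ⟨b, hb⟩ := hbound p w
    refine ⟨b, fun i a => ?_⟩
    obtain ⟨φ, hφ⟩ := exists_formula_of_isDefinableFun subset_rfl (hg i)
    have := hb ⟨_, φ⟩ (g i fun j => ι (a j)) (by
      rw [valueSet_eq_range he hι hφ]
      exact ⟨a, rfl⟩)
    exact (show g i (fun j => ι (a j)) < b from this).le
  · intro k l n m g h hg hh hlt
    obtain ⟨A, hA, hg⟩ := exists_finite_isDefinableFun hg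
    obtain ⟨B, hB, hh⟩ := exists_finite_isDefinableFun hh
    obtain ⟨p, w, -, hw⟩ := (hA.union hB).fin_param
    choose φ hφ using fun i => exists_formula_of_isDefinableFun
      (hw ▸ Set.subset_union_left : A ⊆ Set.range w) (hg i)
    choose ψ hψ using fun i => exists_formula_of_isDefinableFun
      (hw ▸ Set.subset_union_right : B ⊆ Set.range w) (hh i)
    obtain ⟨b, c, hbc, hb, hc⟩ := hgap p (Finset.univ.image fun i => ⟨_, φ i⟩)
      (Finset.univ.image fun i => ⟨_, ψ i⟩) w (by
        simp only [Finset.mem_image, Finset.mem_univ, true_and]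
        rintro _ ⟨i, rfl⟩ y hy _ ⟨j, rfl⟩ z hz
        rw [valueSet_eq_range he hι (hφ i)] at hy
        rw [valueSet_eq_range he hι (hψ j)] at hz
        obtain ⟨a, rfl⟩ := hy
        obtain ⟨a', rfl⟩ := hz
        exact hlt i j a a')
    have hb' : ∀ i (a : Fin (n i) → F), g i (fun s => ι (a s)) < b := fun i a =>
      hb _ (Finset.mem_image_of_mem _ (Finset.mem_univ i)) _ (by
        rw [valueSet_eq_range he hι (hφ i)]
        exact ⟨a, rfl⟩)
    have hc' : ∀ i (a : Fin (m i) → F), c < h i (fun s => ι (a s)) := fun i a =>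
      hc _ (Finset.mem_image_of_mem _ (Finset.mem_univ i)) _ (by
        rw [valueSet_eq_range he hι (hψ i)]
        exact ⟨a, rfl⟩)
    exact ⟨b, ⟨hb', fun j a => hbc.trans (hc' j a)⟩, c,
      ⟨fun i a => (hb' i a).trans hbc, hc'⟩, hbc.ne⟩

end Existence

theorem exists_isSaturatedExtension (F : Subfield ℝ) [Countable F] :
    ∃ (R : Type) (_ : Field R) (_ : LinearOrder R) (_ : IsStrictOrderedRing R) (ι : F →+*o R),
      IsSaturatedExtension ι := by
  have := UltraReal.isRealClosed
  let κ : F →+*o UltraReal :=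
    { (Filter.Germ.coeRingHom _).comp ((Pi.constRingHom ℕ ℝ).comp F.subtype) with
      monotone' := fun a b hab => Filter.Germ.coe_le.2 (Filter.Eventually.of_forall fun _ => hab) }
  obtain ⟨K, ι, hι⟩ := exists_isSaturatedExtension_subfield κ
    fun C D => UltraReal.exists_between
  exact ⟨K, inferInstance, inferInstance, inferInstance, ι, hι⟩

end DistFree

theorem mainTheorem4 (F : Subfield ℝ) [Countable F] :
    (∃ (R : Type) (_ : Field R) (_ : LinearOrder R) (_ : IsStrictOrderedRing R) (ι : F →+*o R),
      DistFree.IsSaturatedExtension ι) ∧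
    ∀ (R : Type*) [Field R] [LinearOrder R] [IsStrictOrderedRing R] (ι : F →+*o R),
      DistFree.IsSaturatedExtension ι →
      ∃ M : (DistFree.starLang F).Structure R,
        DistFree.SameAddOrder M ∧
        (DistFree.starTheory F).Model (M := R) ∧
        (∀ b : R, DistFree.mulIn M b (1 + b) = b + DistFree.mulIn M b b ↔ ∃ a : F, ι a = b) ∧
        ∃ h : R ≃o R, DistFree.IsFBijection ι h ∧ M = DistFree.hInv ι h := by
  refine ⟨DistFree.exists_isSaturatedExtension F, fun R _ _ _ ι hι => ?_⟩
  obtain ⟨h, hh, hgen⟩ := hι.exists_isFBijection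
  refine ⟨DistFree.hInv ι h, DistFree.sameAddOrder_hInv, hh.model_hInv hι, fun b => ⟨fun hb => ?_,
    ?_⟩, h, hh, rfl⟩
  · rw [DistFree.mulIn_hInv, DistFree.mulIn_hInv, ← sq, h.symm_apply_eq] at hb
    exact hgen b hb
  · rintro ⟨a, rfl⟩
    exact hh.distrib_of_map a
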